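/- **Notation.** Let $n\ge1$. For $K=\{k_1<\dots<k_p\}\subseteq\{1,\dots,n\}$ and quaternions $q_1,\dots,q_n$ put $q_K:=q_{k_1}\cdots q_{k_p}$, with $q_\emptyset:=1$. Let $\mathbb S_{\mathbb H}=\{J\in\mathbb H: J^2=-1\}$ and $\mathbb S_{\alpha,\beta}=\{\alpha+J\beta: J\in\mathbb S_{\mathbb H}\}$. Let $D\subseteq\mathbb C^n$ be invariant under the conjugation $z\mapsto\overline z^{\,h}$ of each single variable $z_h$, and let $$\Omega_D=\{(\alpha_1+J_1\beta_1,\dots,\alpha_n+J_n\beta_n): (\alpha_1+i\beta_1,\dots,\alpha_n+i\beta_n)\in D,\ J_1,\dots,J_n\in\mathbb S_{\mathbb H}\}.$$ A stem function on $D$ is a map $F=\sum_{K\subseteq\{1,\dots,n\}}e_KF_K$ with $F_K:D\to\mathbb H$ and $F_K(\overline z^{\,h})=(-1)^{|K\cap\{h\}|}F_K(z)$. It induces the slice function $f=\mathcal I(F):\Omega_D\to\mathbb H$, $f(\alpha_1+J_1\beta_1,\dots,\alpha_n+J_n\beta_n)=\sum_K J_K\,F_K(\alpha_1+i\beta_1,\dots,\alpha_n+i\beta_n)$.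 Stem functions are multiplied by $F\otimes G=\sum_{H,K}(-1)^{|H\cap K|}e_{K\Delta H}F_KG_H$, and $\mathcal I(F)\odot\mathcal I(G):=\mathcal I(F\otimes G)$. The variable $x_j$ is induced by $Z_j=\alpha_j+e_j\beta_j$. With $\mathcal J_h(q\,e_K)=(-1)^{|K\cap\{h\}|}q\,e_{K\Delta\{h\}}$, the function $f$ is called slice regular if $D$ is open, $F$ is of class $C^1$ and $\frac12\big(\frac{\partial F}{\partial\alpha_h}+\mathcal J_h\frac{\partial F}{\partial\beta_h}\big)=0$ for all $h$. The $x_h$-spherical derivative of $f=\mathcal I(F)$ is $f'_{s,h}=\mathcal I(F'_h)$ with $F'_h=\sum_{K\not\ni h}e_K\,\beta_h^{-1}F_{K\cup\{h\}}$, defined where $x_h\notin\mathbb R$. For $1\le m\le n$ write $[m]=\{1,\dots,m\}$, $\Omega_{D}^{m}=\{x\in\Omega_D: x_h\notin\mathbb R\text{ for all }h\le m\}$ and, for $K\subseteq[m]$, $$\mathcal S^m_K(f):=\big(\cdots\big((x_K\odot f)'_{s,1}\big)'_{s,2}\cdots\big)'_{s,m}:\Omega_{D}^{m}\to\mathbb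 H,$$ where $x_K\odot f$ is induced by $Z_{k_1}\otimes\cdots\otimes Z_{k_p}\otimes F$. A slice function on $\Omega$ is circular in $x_h$ if, the other variables being fixed, it is constant on each sphere $\mathbb S_{\alpha,\beta}$; it is slice in $x_h$ if, the other variables being fixed, it is a slice function of the one variable $x_h$. $\Delta_h$ denotes the Laplacian in the four real coordinates of $x_h$. **Statement.** Let $f$ be a slice function on $\Omega_D$ and $1\le m\le n$. Then for all $x\in\Omega_{D}^{m}$ $$f(x)=\sum_{K\subseteq[m]}(-1)^{|[m]\setminus K|}\,(\overline x)_{[m]\setminus K}\,\mathcal S^m_K(f)(x),$$ with the ordinary pointwise product of $\mathbb H$. Moreover, for every $K\subseteq[m]$: 1. $\mathcal S^m_K(f)$ is a slice function on $\Omega_D^{m}$, circular in each of $x_1,\dots,x_m$ and, if $m<n$, slice in $x_{m+1}$. 2. If $f$ is slice regular, then $\mathcal S^m_K(f)$ extends to a continuous function on all of $\Omega_D$, which for every $h\le m$ is of class $C^2$ in $x_h$ and satisfies $\Delta_h\mathcal S^m_K(f)=0$. The decomposition formula and the assertions in 1 hold for these extensions on all of $\Omega_D$. -/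

import Mathlib

open scoped Quaternion

namespace SliceH

noncomputable section

/-- The ordered product `q_K = q_{k₁} ⋯ q_{k_p}`, where `K = {k₁ < ⋯ < k_p}`; `q_∅ = 1`. -/
def orderedProd {n : ℕ} (q : Fin n → ℍ[ℝ]) (K : Finset (Fin n)) : ℍ[ℝ] :=
  (K.sort.map q).prod

/-- The set `𝕊_ℍ` of imaginary units of the quaternions. -/
def imagUnits : Set ℍ[ℝ] := {J | J ^ 2 = -1}

/-- The quaternion `α + J β` associated with `z = α + i β`. -/
def slicePoint (J : ℍ[ℝ]) (z : ℂ) : ℍ[ℝ] := (z.re : ℍ[ℝ]) + J * (z.im : ℍ[ℝ])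

/-- Conjugation of the `h`-th complex variable. -/
def conjAt {n : ℕ} (h : Fin n) (z : Fin n → ℂ) : Fin n → ℂ :=
  Function.update z h (starRingEnd ℂ (z h))

/-- The circularization `Ω_D ⊆ ℍⁿ` of a set `D ⊆ ℂⁿ`. -/
def circularization {n : ℕ} (D : Set (Fin n → ℂ)) : Set (Fin n → ℍ[ℝ]) :=
  {x | ∃ z ∈ D, ∃ J : Fin n → ℍ[ℝ], (∀ h, J h ∈ imagUnits) ∧ ∀ h, x h = slicePoint (J h) (z h)}

/-- Maps into `ℍ ⊗ ℝ^{2ⁿ}`: `F z K` is the coefficient `F_K(z)` in `F = ∑_K e_K F_K`. -/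
abbrev StemMap (n : ℕ) := (Fin n → ℂ) → Finset (Fin n) → ℍ[ℝ]

/-- `F` is a stem function on `D`: the set `D` is invariant under the conjugation of each variable,
and `F_K(z̄^h) = (-1)^{|K ∩ {h}|} F_K(z)` on `D`. -/
structure IsStem {n : ℕ} (D : Set (Fin n → ℂ)) (F : StemMap n) : Prop where
  conj_mem : ∀ h, ∀ z ∈ D, conjAt h z ∈ D
  conj_eq : ∀ h, ∀ z ∈ D, ∀ K, F (conjAt h z) K = (-1) ^ (K ∩ {h}).card * F z K

/-- The imaginary part `β = |Im q|` and real part `α` of a quaternion, as the complex number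
`α + i β` of the closed upper half plane. -/
def toComplex (q : ℍ[ℝ]) : ℂ := ⟨q.re, ‖q.im‖⟩

/-- The imaginary unit `Im q / |Im q|` of a non-real quaternion (and `0` for a real one). -/
def unitOf (q : ℍ[ℝ]) : ℍ[ℝ] := ‖q.im‖⁻¹ • q.im

/-- The function `𝓘(F)` induced by a stem function `F`, computed from the representation
`x_h = α_h + J_h β_h` with `β_h ≥ 0`. That all representations give the same value is
`inducedFun_eq`. -/
def inducedFun {n : ℕ} (F : StemMap n) (x : Fin n → ℍ[ℝ]) : ℍ[ℝ] :=
  ∑ K : Finset (Fin n),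
    orderedProd (fun h => unitOf (x h)) K * F (fun h => toComplex (x h)) K

/-- `f` is a slice function on `Ω`, i.e. `Ω` is the circularization of some `D` and `f` is induced
on it by a stem function on `D`. Only the values of `f` on `Ω` matter. -/
def IsSlice {n : ℕ} (Ω : Set (Fin n → ℍ[ℝ])) (f : (Fin n → ℍ[ℝ]) → ℍ[ℝ]) : Prop :=
  ∃ (D : Set (Fin n → ℂ)) (F : StemMap n),
    IsStem D F ∧ Ω = circularization D ∧ Set.EqOn f (inducedFun F) Ω

/-- The complex structure `𝓙_h(q ⊗ e_K) = (-1)^{|K ∩ {h}|} q ⊗ e_{K Δ {h}}` on `ℍ ⊗ ℝ^{2ⁿ}`,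
in coefficients. -/
def stemJ {n : ℕ} (h : Fin n) (a : Finset (Fin n) → ℍ[ℝ]) : Finset (Fin n) → ℍ[ℝ] :=
  fun K => (-1) ^ (symmDiff K {h} ∩ {h}).card * a (symmDiff K {h})

/-- `∂F/∂α_h`, coefficientwise, where `z_h = α_h + i β_h`. -/
def dAlpha {n : ℕ} (h : Fin n) (F : StemMap n) : StemMap n :=
  fun z K => fderiv ℝ (fun w => F w K) z (Pi.single h 1)

/-- `∂F/∂β_h`, coefficientwise, where `z_h = α_h + i β_h`. -/
def dBeta {n : ℕ} (h : Fin n) (F : StemMap n) : StemMap n :=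
  fun z K => fderiv ℝ (fun w => F w K) z (Pi.single h Complex.I)

/-- The operator `∂̄_h = ½ (∂/∂α_h + 𝓙_h ∂/∂β_h)`. -/
def dBar {n : ℕ} (h : Fin n) (F : StemMap n) : StemMap n :=
  fun z K => (1 / 2 : ℝ) • (dAlpha h F z K + stemJ h (dBeta h F z) K)

/-- `F` is of class `C¹` on `D` and `∂̄_h F = 0` there for every `h` (used for open `D`). -/
def IsHolomorphic {n : ℕ} (D : Set (Fin n → ℂ)) (F : StemMap n) : Prop :=
  (∀ K, ContDiffOn ℝ 1 (fun z => F z K) D) ∧ ∀ h, ∀ z ∈ D, dBar h F z = 0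

/-- `f` is slice regular on `Ω = Ω_D`, `D` open: induced by a holomorphic stem function on `D`. -/
def IsSliceRegular {n : ℕ} (Ω : Set (Fin n → ℍ[ℝ])) (f : (Fin n → ℍ[ℝ]) → ℍ[ℝ]) : Prop :=
  ∃ (D : Set (Fin n → ℂ)) (F : StemMap n), IsOpen D ∧ IsStem D F ∧ IsHolomorphic D F ∧
    Ω = circularization D ∧ Set.EqOn f (inducedFun F) Ω

/-- `f` is slice on `Ω` and slice with respect to `x_h`: for every `y ∈ Ω`, the restriction
`x ↦ f(y₁, …, y_{h-1}, x, y_{h+1}, …, y_n)` is a slice function of one variable on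
`{x | (y₁, …, y_{h-1}, x, y_{h+1}, …, y_n) ∈ Ω}`. Here `ℍ` is `Fin 1 → ℍ`. -/
def IsSliceIn {n : ℕ} (Ω : Set (Fin n → ℍ[ℝ])) (h : Fin n) (f : (Fin n → ℍ[ℝ]) → ℍ[ℝ]) : Prop :=
  IsSlice Ω f ∧ ∀ y ∈ Ω,
    IsSlice {x : Fin 1 → ℍ[ℝ] | Function.update y h (x 0) ∈ Ω}
      (fun x => f (Function.update y h (x 0)))

/-- `f` is slice on `Ω` and circular with respect to `x_h`: every restriction of `f` to the
variable `x_h` is constant on the spheres `𝕊_{α,β} = {α + J β | J ∈ 𝕊_ℍ}`. -/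
def IsCircularIn {n : ℕ} (Ω : Set (Fin n → ℍ[ℝ])) (h : Fin n) (f : (Fin n → ℍ[ℝ]) → ℍ[ℝ]) :
    Prop :=
  IsSlice Ω f ∧ ∀ y ∈ Ω, ∀ z : ℂ, ∀ I ∈ imagUnits, ∀ J ∈ imagUnits,
    Function.update y h (slicePoint I z) ∈ Ω → Function.update y h (slicePoint J z) ∈ Ω →
      f (Function.update y h (slicePoint I z)) = f (Function.update y h (slicePoint J z))

/-- `f` is harmonic with respect to `x_h` on `Ω`: at every point of `Ω` the function of the four
real coordinates of `x_h` is of class `C²` and its Laplacian `Δ_h f` vanishes nearby. -/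
def IsHarmonicIn {n : ℕ} (Ω : Set (Fin n → ℍ[ℝ])) (h : Fin n) (f : (Fin n → ℍ[ℝ]) → ℍ[ℝ]) :
    Prop :=
  ∀ y ∈ Ω, InnerProductSpace.HarmonicAt (fun q : ℍ[ℝ] => f (Function.update y h q)) (y h)

/-- The product of stem functions,
`F ⊗ G = ∑_{H,K} (-1)^{|H ∩ K|} e_{K Δ H} F_K G_H`, in coefficients. -/
def stemMul {n : ℕ} (F G : StemMap n) : StemMap n :=
  fun z T => ∑ K : Finset (Fin n), ∑ H : Finset (Fin n),
    if symmDiff K H = T then (-1) ^ (H ∩ K).card * (F z K * G z H) else 0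

/-- The stem function `Z_j = α_j + e_j β_j`, which induces the monomial `x_j`. -/
def stemVar {n : ℕ} (j : Fin n) : StemMap n :=
  fun z K => if K = ∅ then ((z j).re : ℍ[ℝ]) else if K = {j} then ((z j).im : ℍ[ℝ]) else 0

/-- `Z_K ⊗ F = Z_{k₁} ⊗ (⋯ ⊗ (Z_{k_p} ⊗ F))`, where `K = {k₁ < ⋯ < k_p}`; it induces
`x_K ⊙ f` if `F` induces `f`. -/
def stemVarMul {n : ℕ} (K : Finset (Fin n)) (F : StemMap n) : StemMap n :=
  K.sort.foldr (fun k G => stemMul (stemVar k) G) F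

/-- `F'_h = ∑_{h ∉ K} e_K β_h⁻¹ F_{K ∪ {h}}`, which induces the `x_h`-spherical derivative. It is
meaningful where `β_h ≠ 0`. -/
def sphDeriv {n : ℕ} (h : Fin n) (F : StemMap n) : StemMap n :=
  fun z K => if h ∈ K then 0 else ((z h).im)⁻¹ • F z (insert h K)

/-- `F'_H = (⋯ ((F'_{h₁})'_{h₂}) ⋯)'_{h_p}`, where `H = {h₁ < ⋯ < h_p}`. -/
def sphDerivs {n : ℕ} (H : Finset (Fin n)) (F : StemMap n) : StemMap n :=
  H.sort.foldl (fun G h => sphDeriv h G) F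

/-- The component `𝓢^H_K(f) = (x_K ⊙ f)'_{s,H}` of the slice function `f = 𝓘(F)`, that is, the
function induced by `(Z_K ⊗ F)'_H`. -/
def component {n : ℕ} (H K : Finset (Fin n)) (F : StemMap n) : (Fin n → ℍ[ℝ]) → ℍ[ℝ] :=
  inducedFun (sphDerivs H (stemVarMul K F))

/-- `D_H`: the points of `D` with `z_h` non-real for every `h ∈ H`. -/
def nonrealPart {n : ℕ} (H : Finset (Fin n)) (D : Set (Fin n → ℂ)) : Set (Fin n → ℂ) :=
  {z ∈ D | ∀ h ∈ H, (z h).im ≠ 0}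

/-- The set `{1, …, m}` of the first `m` of the `n` indices. -/
def firstVars (n m : ℕ) : Finset (Fin n) := Finset.univ.filter fun h => h.val < m

/-! ### The induced function does not depend on the representation of the point -/

theorem im_slicePoint_mem {J : ℍ[ℝ]} (hJ : J ∈ imagUnits) : J.re = 0 ∧ ‖J‖ = 1 := by
  have h2 : J ^ 2 = -1 := hJ
  have hn : ‖J‖ = 1 := by
    have h3 : ‖J‖ ^ 2 = 1 := by rw [← norm_pow, h2, norm_neg, norm_one]
    nlinarith [norm_nonneg J]
  have hs := Quaternion.sq_eq_neg_normSq (a := J)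
  refine ⟨hs.1 ?_, hn⟩
  rw [h2, Quaternion.normSq_eq_norm_mul_self, hn]
  simp

theorem toComplex_slicePoint {J : ℍ[ℝ]} (hJ : J ∈ imagUnits) (z : ℂ) :
    toComplex (slicePoint J z) = ⟨z.re, |z.im|⟩ := by
  obtain ⟨h0, h1⟩ := im_slicePoint_mem hJ
  have him : (slicePoint J z).im = J * (z.im : ℍ[ℝ]) := by
    ext <;> simp [slicePoint, h0]
  apply Complex.ext
  · simp [toComplex, slicePoint, h0]
  · simp [toComplex, him, h1]

theorem unitOf_slicePoint {J : ℍ[ℝ]} (hJ : J ∈ imagUnits) (z : ℂ) :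
    unitOf (slicePoint J z) = (|z.im|⁻¹ * z.im) • J := by
  obtain ⟨h0, h1⟩ := im_slicePoint_mem hJ
  have him : (slicePoint J z).im = z.im • J := by
    ext <;> simp [slicePoint, h0, mul_comm]
  rw [unitOf, him, norm_smul, h1, mul_one, Real.norm_eq_abs, smul_smul]

theorem orderedProd_smul {n : ℕ} (c : Fin n → ℝ) (q : Fin n → ℍ[ℝ]) (K : Finset (Fin n)) :
    orderedProd (fun h => c h • q h) K = (∏ h ∈ K, c h) • orderedProd q K := by
  have key : ∀ l : List (Fin n),
      (l.map fun h => c h • q h).prod = (l.map c).prod • (l.map q).prod := by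
    intro l
    induction l with
    | nil => simp
    | cons a l ih => simp [ih, smul_smul, mul_comm]
  rw [orderedProd, key, orderedProd]
  congr 1
  conv_rhs => rw [Finset.prod, ← Finset.sort_eq K (· ≤ ·)]
  rw [Multiset.map_coe, Multiset.prod_coe]

theorem IsStem.abs_im {n : ℕ} {D : Set (Fin n → ℂ)} {F : StemMap n} (hF : IsStem D F)
    {z : Fin n → ℂ} (hz : z ∈ D) (K : Finset (Fin n)) :
    (fun h => (⟨(z h).re, |(z h).im|⟩ : ℂ)) ∈ D ∧
    (∏ h ∈ K, (|(z h).im|⁻¹ * (z h).im)) • F (fun h => ⟨(z h).re, |(z h).im|⟩) K = F z K := by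
  classical
  -- conjugating all variables in `N` at once
  have key : ∀ N : Finset (Fin n),
      (fun h => if h ∈ N then starRingEnd ℂ (z h) else z h) ∈ D ∧
      F (fun h => if h ∈ N then starRingEnd ℂ (z h) else z h) K
        = (∏ h ∈ K, (if h ∈ N then (-1 : ℝ) else 1)) • F z K := by
    intro N
    induction N using Finset.induction_on with
    | empty => simpa using hz
    | insert a N ha ih =>
      have e : (fun h => if h ∈ insert a N then starRingEnd ℂ (z h) else z h)
          = conjAt a (fun h => if h ∈ N then starRingEnd ℂ (z h) else z h) := by
        funext h
        by_cases hh : h = a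
        · subst hh; simp [conjAt, ha]
        · simp [conjAt, hh]
      rw [e]
      refine ⟨hF.conj_mem _ _ ih.1, ?_⟩
      rw [hF.conj_eq _ _ ih.1, ih.2]
      by_cases haK : a ∈ K
      · have : K ∩ {a} = {a} := by simpa using haK
        rw [this, ← Finset.mul_prod_erase K _ haK, ← Finset.mul_prod_erase K _ haK]
        have e2 : ∏ h ∈ K.erase a, (if h ∈ insert a N then (-1 : ℝ) else 1)
            = ∏ h ∈ K.erase a, (if h ∈ N then (-1 : ℝ) else 1) :=
          Finset.prod_congr rfl fun h hh => by simp [Finset.ne_of_mem_erase hh]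
        rw [e2]
        simp [ha]
      · have : K ∩ {a} = ∅ := Finset.inter_singleton_of_notMem haK
        rw [this]
        have e2 : ∏ h ∈ K, (if h ∈ insert a N then (-1 : ℝ) else 1)
            = ∏ h ∈ K, (if h ∈ N then (-1 : ℝ) else 1) :=
          Finset.prod_congr rfl fun h hh => by
            have : h ≠ a := fun hc => haK (hc ▸ hh)
            simp [this]
        rw [e2]
        simp
  have e : (fun h => (⟨(z h).re, |(z h).im|⟩ : ℂ))
      = fun h => if h ∈ Finset.univ.filter (fun h => (z h).im < 0)
          then starRingEnd ℂ (z h) else z h := by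
    funext h
    by_cases hh : (z h).im < 0
    · apply Complex.ext <;> simp [hh, abs_of_neg]
    · apply Complex.ext <;> simp [hh, abs_of_nonneg (not_lt.1 hh)]
  obtain ⟨k1, k2⟩ := key (Finset.univ.filter (fun h => (z h).im < 0))
  rw [e]
  refine ⟨k1, ?_⟩
  rw [k2, smul_smul, ← Finset.prod_mul_distrib]
  by_cases h0 : ∃ h ∈ K, (z h).im = 0
  · obtain ⟨h, hK, hz0⟩ := h0
    have hc : conjAt h z = z := by
      have : starRingEnd ℂ (z h) = z h := Complex.conj_eq_iff_im.2 hz0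
      rw [conjAt, this, Function.update_eq_self]
    have hFz := hF.conj_eq h z hz K
    have hcap : K ∩ {h} = {h} := by simpa using hK
    rw [hc, hcap] at hFz
    have : F z K = 0 := by
      have h2 : F z K = -F z K := by simpa using hFz
      have h3 : (2 : ℝ) • F z K = 0 := by
        rw [two_smul]
        nth_rewrite 2 [h2]
        exact add_neg_cancel _
      exact (smul_eq_zero.1 h3).resolve_left two_ne_zero
    rw [this, smul_zero]
  · push Not at h0
    rw [Finset.prod_eq_one, one_smul]
    intro h hK
    have hne := h0 h hK
    by_cases hh : (z h).im < 0
    · simp [hh, abs_of_neg]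
      field_simp
    · simp [hh, abs_of_nonneg (not_lt.1 hh), hne]

/-- `𝓘(F)(α₁ + J₁ β₁, …, α_n + J_n β_n) = ∑_K [J_K, F_K(z)]` for all `z ∈ D` and `J_h ∈ 𝕊_ℍ`. -/
theorem inducedFun_eq {n : ℕ} {D : Set (Fin n → ℂ)} {F : StemMap n} (hF : IsStem D F)
    {z : Fin n → ℂ} (hz : z ∈ D) {J : Fin n → ℍ[ℝ]} (hJ : ∀ h, J h ∈ imagUnits) :
    inducedFun F (fun h => slicePoint (J h) (z h))
      = ∑ K : Finset (Fin n), orderedProd J K * F z K := by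
  refine Finset.sum_congr rfl fun K _ => ?_
  simp only [unitOf_slicePoint (hJ _), toComplex_slicePoint (hJ _)]
  rw [orderedProd_smul, smul_mul_assoc, ← mul_smul_comm, (hF.abs_im hz K).2]

end

end SliceH

/-! The decomposition peels off one variable at a time. Let `G` be a stem function whose
coefficients vanish on sets meeting the variables before `x_j`. Put `Q = G'_j` and `P = (Z_j ⊗
G)'_j`. Then `β_j Q_T = G_{T ∪ {j}}` and `P_T = G_T + α_j Q_T` for `j ∉ T`. Only index sets with all
elements at least `j` contribute, so the unit `J_j` stands leftmost in every product that contains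
it. Hence the induced values satisfy `g = p - (α_j - J_j β_j) q = p - x̄_j q`
(`decomposition_step`). Iterating over the first `m` variables gives the formula (`decomposition`),
because `Z_j` commutes with the spherical derivatives in the other variables. Since no coefficient
indexed by a set meeting the first `m` variables survives, circularity in those variables and
sliceness in the next one can be read off the formula for the induced function.

For a slice regular function, each pair `F_T, F_{T ∪ {h}}`, composed with a real functional, gives
the real and imaginary parts of a holomorphic function `φ` of `z_h` with `φ(w̄)` conjugate to
`φ(w)`. Its spherical derivative `Im φ(w) / Im w` is a Cauchy integral against `1/((ζ - α)² + β²)`.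
Two things follow. The integral is `C¹` in all variables, also across real `z_h`, which extends the
components (`contDiffAt_regDeriv_of_im_eq_zero`). With `β = |Im q|` the kernel is a translate of the
Newtonian kernel `1/|x|²` of `ℝ⁴`, hence harmonic in `q` (`laplace_quatQuad_inv`,
`harmonicAt_complexSphDeriv`). Algebraic identities pass to the extensions by density of the points
with non-real coordinates. Finally, the stem function inducing `f` is unique, so regularity of `f`
is a property of the given `F`. -/

open scoped Quaternion

namespace SliceH

noncomputable section

/-! ### Smoothness of integrals depending on a parameter. -/

section Parametric

variable {E F : Type} [NormedAddCommGroup E] [NormedSpace ℝ E]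
  [NormedAddCommGroup F] [NormedSpace ℝ F]

open Set Topology

theorem fderiv_section {Φ : E → ℝ → F} {U : Set E} (hU : IsOpen U)
    (hΦ : ContDiffOn ℝ 1 (Function.uncurry Φ) (U ×ˢ univ)) {q : E} (hq : q ∈ U) (t : ℝ) :
    HasFDerivAt (fun q => Φ q t)
      ((fderiv ℝ (Function.uncurry Φ) (q, t)).comp (ContinuousLinearMap.inl ℝ E ℝ)) q := by
  have h1 : DifferentiableAt ℝ (Function.uncurry Φ) (q, t) :=
    (hΦ.contDiffAt ((hU.prod isOpen_univ).mem_nhds ⟨hq, mem_univ t⟩)).differentiableAt (by simp)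
  exact HasFDerivAt.comp (g := Function.uncurry Φ) (f := fun q => (q, t)) q h1.hasFDerivAt
    (hasFDerivAt_prodMk_left q t)

theorem contDiffOn_fderiv_section {Φ : E → ℝ → F} {U : Set E} (hU : IsOpen U) {k : ℕ}
    (hΦ : ContDiffOn ℝ (k + 1) (Function.uncurry Φ) (U ×ˢ univ)) :
    ContDiffOn ℝ k (Function.uncurry fun q t => fderiv ℝ (fun q => Φ q t) q) (U ×ˢ univ) := by
  have h1 : ContDiffOn ℝ k (fderiv ℝ (Function.uncurry Φ)) (U ×ˢ univ) :=
    hΦ.fderiv_of_isOpen (hU.prod isOpen_univ) le_rfl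
  have h2 : ContDiffOn ℝ k (fun p => (fderiv ℝ (Function.uncurry Φ) p).comp
      (ContinuousLinearMap.inl ℝ E ℝ)) (U ×ˢ univ) :=
    h1.clm_comp contDiffOn_const
  refine h2.congr ?_
  rintro ⟨q, t⟩ ⟨hq, -⟩
  exact (fderiv_section hU (hΦ.of_le (by simp)) hq t).fderiv

/-- Finite dimension makes a small closed ball times the interval of integration compact, so the
derivative of the integrand is bounded there by a constant, which serves as the dominating function.
-/
theorem hasFDerivAt_integral [FiniteDimensional ℝ E] {Φ : E → ℝ → F} {U : Set E} (hU : IsOpen U)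
    (hΦ : ContDiffOn ℝ 1 (Function.uncurry Φ) (U ×ˢ univ)) (a b : ℝ) {q : E} (hq : q ∈ U) :
    HasFDerivAt (fun q => ∫ t in a..b, Φ q t)
      (∫ t in a..b, fderiv ℝ (fun q => Φ q t) q) q := by
  obtain ⟨r, hr, hrU⟩ := Metric.nhds_basis_closedBall.mem_iff.1 (hU.mem_nhds hq)
  have hc : ContinuousOn (Function.uncurry fun q t => fderiv ℝ (fun q => Φ q t) q)
      (U ×ˢ univ) := by
    have := contDiffOn_fderiv_section (k := 0) hU (by simpa using hΦ)
    exact this.continuousOn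
  obtain ⟨C, hC⟩ := ((isCompact_closedBall q r).prod (isCompact_uIcc (a := a) (b := b))).exists_bound_of_continuousOn
    (hc.mono (prod_mono hrU (subset_univ _)))
  refine (intervalIntegral.hasFDerivAt_integral_of_dominated_of_fderiv_le (𝕜 := ℝ)
    (F := Φ) (F' := fun q t => fderiv ℝ (fun q => Φ q t) q)
    (bound := fun _ => C) (Metric.ball_mem_nhds q hr) ?_ ?_ ?_ ?_ ?_ ?_)
  · filter_upwards [hU.mem_nhds hq] with p hp
    have : Continuous (Φ p) :=
      continuousOn_univ.1 (hΦ.continuousOn.comp (f := fun t => (p, t)) (by fun_prop)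
        (fun t _ => ⟨hp, mem_univ t⟩))
    exact this.aestronglyMeasurable
  · have : Continuous (Φ q) :=
      continuousOn_univ.1 (hΦ.continuousOn.comp (f := fun t => (q, t)) (by fun_prop)
        (fun t _ => ⟨hq, mem_univ t⟩))
    exact this.intervalIntegrable _ _
  · have : Continuous (fun t => fderiv ℝ (fun q => Φ q t) q) :=
      continuousOn_univ.1 (hc.comp (f := fun t => (q, t)) (by fun_prop)
        (fun t _ => ⟨hq, mem_univ t⟩))
    exact this.aestronglyMeasurable
  · refine Filter.Eventually.of_forall fun t ht p hp => ?_
    exact hC (p, t) ⟨Metric.ball_subset_closedBall hp, uIoc_subset_uIcc ht⟩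
  · exact intervalIntegrable_const
  · refine Filter.Eventually.of_forall fun t ht p hp => ?_
    have hpU := hrU (Metric.ball_subset_closedBall hp)
    have := fderiv_section hU hΦ hpU t
    rwa [this.fderiv]

/-- The target space is quantified inside the statement because the induction step applies the
hypothesis to the derivative, whose values lie in `E →L[ℝ] F`. -/
theorem contDiffOn_integral [FiniteDimensional ℝ E] {U : Set E} (hU : IsOpen U) (a b : ℝ) (k : ℕ) :
    ∀ {F : Type} [NormedAddCommGroup F] [NormedSpace ℝ F] {Φ : E → ℝ → F},
    ContDiffOn ℝ k (Function.uncurry Φ) (U ×ˢ univ) →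
    ContDiffOn ℝ k (fun q => ∫ t in a..b, Φ q t) U := by
  induction k with
  | zero =>
    intro F _ _ Φ hΦ
    simp only [Nat.cast_zero, contDiffOn_zero] at hΦ ⊢
    rw [continuousOn_iff_continuous_domRestrict]
    refine intervalIntegral.continuous_parametric_intervalIntegral_of_continuous'
      (f := fun (q : U) t => Φ q t) ?_ a b
    exact hΦ.comp_continuous (f := fun p : U × ℝ => ((p.1 : E), p.2)) (by fun_prop)
      (fun p => ⟨p.1.2, mem_univ _⟩)
  | succ k ih =>
    intro F _ _ Φ hΦ
    push_cast at hΦ ⊢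
    have h1 := fun q (hq : q ∈ U) => hasFDerivAt_integral hU (hΦ.of_le (by simp)) a b hq
    rw [contDiffOn_succ_iff_fderiv_of_isOpen hU]
    refine ⟨fun q hq => (h1 q hq).differentiableAt.differentiableWithinAt, by simp, ?_⟩
    exact (ih (contDiffOn_fderiv_section hU hΦ)).congr fun q hq => (h1 q hq).fderiv

end Parametric

/-! ### Quaternionic coordinates and harmonicity under the integral sign. -/

/-- The standard orthonormal basis `1, i, j, k` of the quaternions. -/
def quatBasis : OrthonormalBasis (Fin 4) ℝ ℍ[ℝ] :=
  ⟨Quaternion.linearIsometryEquivTuple⟩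

theorem harmonicOnNhd_of_fderiv {E F : Type} [NormedAddCommGroup E] [InnerProductSpace ℝ E]
    [FiniteDimensional ℝ E] [NormedAddCommGroup F] [NormedSpace ℝ F] {ι : Type} [Fintype ι]
    (b : OrthonormalBasis ι ℝ E) {U : Set E} (hU : IsOpen U) {f : E → F}
    (hf : ContDiffOn ℝ 2 f U)
    (h0 : ∀ q ∈ U, ∑ i, fderiv ℝ (fderiv ℝ f) q (b i) (b i) = 0) :
    InnerProductSpace.HarmonicOnNhd f U := by
  intro q hq
  refine ⟨hf.contDiffAt (hU.mem_nhds hq), ?_⟩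
  filter_upwards [hU.mem_nhds hq] with p hp
  rw [InnerProductSpace.laplacian_eq_iteratedFDeriv_orthonormalBasis f b]
  simpa [iteratedFDeriv_two_apply] using h0 p hp

open Set in
theorem harmonicOnNhd_integral {E F : Type} [NormedAddCommGroup E] [InnerProductSpace ℝ E]
    [FiniteDimensional ℝ E] [NormedAddCommGroup F] [NormedSpace ℝ F] [CompleteSpace F]
    {ι : Type} [Fintype ι]
    (b : OrthonormalBasis ι ℝ E) {U : Set E} (hU : IsOpen U) {Φ : E → ℝ → F}
    (hΦ : ContDiffOn ℝ 2 (Function.uncurry Φ) (U ×ˢ univ))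
    (h0 : ∀ t, ∀ q ∈ U, ∑ i, fderiv ℝ (fderiv ℝ (fun q => Φ q t)) q (b i) (b i) = 0)
    (s t : ℝ) :
    InnerProductSpace.HarmonicOnNhd (fun q => ∫ τ in s..t, Φ q τ) U := by
  refine harmonicOnNhd_of_fderiv b hU (contDiffOn_integral hU s t 2 hΦ) fun q hq => ?_
  have hΦ1 : ContDiffOn ℝ (1 : ℕ) (Function.uncurry fun q t => fderiv ℝ (fun q => Φ q t) q)
      (U ×ˢ univ) := contDiffOn_fderiv_section hU (by exact_mod_cast hΦ)
  have hΦ2 : ContDiffOn ℝ (0 : ℕ) (Function.uncurry fun q t =>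
      fderiv ℝ (fun q => fderiv ℝ (fun q => Φ q t) q) q)
      (U ×ˢ univ) := contDiffOn_fderiv_section hU (by exact_mod_cast hΦ1)
  have e1 : fderiv ℝ (fun q => ∫ τ in s..t, Φ q τ) =ᶠ[nhds q]
      fun q => ∫ τ in s..t, fderiv ℝ (fun q => Φ q τ) q := by
    filter_upwards [hU.mem_nhds hq] with p hp
    exact (hasFDerivAt_integral hU (hΦ.of_le (by norm_num)) s t hp).fderiv
  have hcont : Continuous fun τ => fderiv ℝ (fun q => fderiv ℝ (fun q => Φ q τ) q) q :=
    continuousOn_univ.1 (hΦ2.continuousOn.comp (f := fun t => (q, t)) (by fun_prop)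
        (fun t _ => ⟨hq, mem_univ t⟩))
  have hint : ∀ e : E, IntervalIntegrable
      (fun τ => fderiv ℝ (fun q => fderiv ℝ (fun q => Φ q τ) q) q e) MeasureTheory.volume s t :=
    fun e => (hcont.clm_apply continuous_const).intervalIntegrable _ _
  rw [e1.fderiv_eq, (hasFDerivAt_integral hU (by exact_mod_cast hΦ1) s t hq).fderiv]
  have e2 : ∀ e : E, (∫ τ in s..t, fderiv ℝ (fun q => fderiv ℝ (fun q => Φ q τ) q) q) e e
      = ∫ τ in s..t, fderiv ℝ (fun q => fderiv ℝ (fun q => Φ q τ) q) q e e := by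
    intro e
    rw [ContinuousLinearMap.intervalIntegral_apply (hcont.intervalIntegrable _ _),
      ContinuousLinearMap.intervalIntegral_apply (hint e)]
  simp only [e2]
  rw [← intervalIntegral.integral_finsetSum]
  · rw [← intervalIntegral.integral_zero (a := s) (b := t) (μ := MeasureTheory.volume)]
    congr 1
    funext τ
    exact h0 τ q hq
  · intro i _
    exact ((hcont.clm_apply continuous_const).clm_apply continuous_const).intervalIntegrable _ _

theorem quatBasis_re (i : Fin 4) : (quatBasis i).re = if 0 = i then 1 else 0 := by
  have h : (quatBasis.repr (quatBasis i)) 0 = if 0 = i then 1 else 0 := by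
    rw [quatBasis.repr_self]
    simp [eq_comm]
  exact h

theorem quatBasis_imI (i : Fin 4) : (quatBasis i).imI = if 1 = i then 1 else 0 := by
  have h : (quatBasis.repr (quatBasis i)) 1 = if 1 = i then 1 else 0 := by
    rw [quatBasis.repr_self]
    simp [eq_comm]
  exact h

theorem quatBasis_imJ (i : Fin 4) : (quatBasis i).imJ = if 2 = i then 1 else 0 := by
  have h : (quatBasis.repr (quatBasis i)) 2 = if 2 = i then 1 else 0 := by
    rw [quatBasis.repr_self]
    simp [eq_comm]
  exact h

theorem quatBasis_imK (i : Fin 4) : (quatBasis i).imK = if 3 = i then 1 else 0 := by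
  have h : (quatBasis.repr (quatBasis i)) 3 = if 3 = i then 1 else 0 := by
    rw [quatBasis.repr_self]
    simp [eq_comm]
  exact h

/-! ### The kernel of four-dimensional potential theory, with a complex pole. -/

/-- The function `(ζ - α)² + |v|²` of the quaternion `q = α + v`. -/
def quatQuad (ζ : ℂ) (q : ℍ[ℝ]) : ℂ :=
  (ζ - q.re) ^ 2 + ((q.imI ^ 2 + q.imJ ^ 2 + q.imK ^ 2 : ℝ) : ℂ)

/-- Polarization of `quatQuad`. -/
def quatQuadPolar (ζ : ℂ) (q e : ℍ[ℝ]) : ℂ :=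
  -2 * (ζ - q.re) * e.re + ((2 * (q.imI * e.imI + q.imJ * e.imJ + q.imK * e.imK) : ℝ) : ℂ)

/-- Along a line the function is a quadratic polynomial, so all derivatives needed for the Laplacian
reduce to one-variable ones. -/
theorem quatQuad_add_smul (ζ : ℂ) (q e : ℍ[ℝ]) (t : ℝ) :
    quatQuad ζ (q + t • e) = quatQuad ζ q + t * quatQuadPolar ζ q e
      + t ^ 2 * ((e.re ^ 2 + e.imI ^ 2 + e.imJ ^ 2 + e.imK ^ 2 : ℝ) : ℂ) := by
  simp [quatQuad, quatQuadPolar]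
  ring

theorem quatQuadPolar_add_smul (ζ : ℂ) (q e : ℍ[ℝ]) (t : ℝ) :
    quatQuadPolar ζ (q + t • e) e = quatQuadPolar ζ q e
      + t * ((2 * (e.re ^ 2 + e.imI ^ 2 + e.imJ ^ 2 + e.imK ^ 2) : ℝ) : ℂ) := by
  simp [quatQuadPolar]
  ring

theorem contDiff_quatQuad (k : WithTop ℕ∞) : ContDiff ℝ k fun p : ℍ[ℝ] × ℂ => quatQuad p.2 p.1 := by
  have h : ∀ l : ℍ[ℝ] →ₗ[ℝ] ℝ, ContDiff ℝ k fun p : ℍ[ℝ] × ℂ => l p.1 := fun l =>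
    (LinearMap.toContinuousLinearMap l).contDiff.comp contDiff_fst
  have hre : ContDiff ℝ k fun p : ℍ[ℝ] × ℂ => p.1.re := h (QuaternionAlgebra.reₗ _ _ _)
  have hI : ContDiff ℝ k fun p : ℍ[ℝ] × ℂ => p.1.imI := h (QuaternionAlgebra.imIₗ _ _ _)
  have hJ : ContDiff ℝ k fun p : ℍ[ℝ] × ℂ => p.1.imJ := h (QuaternionAlgebra.imJₗ _ _ _)
  have hK : ContDiff ℝ k fun p : ℍ[ℝ] × ℂ => p.1.imK := h (QuaternionAlgebra.imKₗ _ _ _)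
  have hc : ContDiff ℝ k (fun x : ℝ => (x : ℂ)) := Complex.ofRealCLM.contDiff
  unfold quatQuad
  exact ((contDiff_snd.sub (hc.comp hre)).pow 2).add (hc.comp (((hI.pow 2).add (hJ.pow 2)).add (hK.pow 2)))

theorem contDiff_quatQuad_right (k : WithTop ℕ∞) (ζ : ℂ) : ContDiff ℝ k (quatQuad ζ) :=
  ContDiff.comp (g := fun p : ℍ[ℝ] × ℂ => quatQuad p.2 p.1) (f := fun q : ℍ[ℝ] => (q, ζ))
    (contDiff_quatQuad k) (contDiff_prodMk_left ζ)

theorem hasDerivAt_line_polar (ζ : ℂ) (q e : ℍ[ℝ]) :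
    HasDerivAt (fun t : ℝ => quatQuad ζ (q + t • e)) (quatQuadPolar ζ q e) 0 := by
  simp only [quatQuad_add_smul]
  have h1 : HasDerivAt (fun t : ℝ => (t : ℂ)) 1 0 := Complex.ofRealCLM.hasDerivAt
  have h2 := ((h1.mul_const (quatQuadPolar ζ q e)).const_add (quatQuad ζ q)).add
    ((h1.pow 2).mul_const (((e.re ^ 2 + e.imI ^ 2 + e.imJ ^ 2 + e.imK ^ 2 : ℝ) : ℂ)))
  refine h2.congr_deriv ?_
  simp

theorem hasDerivAt_line_polar' (ζ : ℂ) (q e : ℍ[ℝ]) :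
    HasDerivAt (fun t : ℝ => quatQuadPolar ζ (q + t • e) e)
      ((2 * (e.re ^ 2 + e.imI ^ 2 + e.imJ ^ 2 + e.imK ^ 2) : ℝ) : ℂ) 0 := by
  simp only [quatQuadPolar_add_smul]
  have h1 : HasDerivAt (fun t : ℝ => (t : ℂ)) 1 0 := Complex.ofRealCLM.hasDerivAt
  have h2 := (h1.mul_const (((2 * (e.re ^ 2 + e.imI ^ 2 + e.imJ ^ 2 + e.imK ^ 2) : ℝ) : ℂ))).const_add (quatQuadPolar ζ q e)
  refine h2.congr_deriv ?_
  simp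

theorem fderiv_apply_of_line {E F : Type} [NormedAddCommGroup E] [NormedSpace ℝ E]
    [NormedAddCommGroup F] [NormedSpace ℝ F] {f : E → F} {q e : E} {v : F}
    (hf : DifferentiableAt ℝ f q) (h : HasDerivAt (fun t : ℝ => f (q + t • e)) v 0) :
    fderiv ℝ f q e = v := by
  have h2 : HasLineDerivAt ℝ f (fderiv ℝ f q e) q e := hf.hasFDerivAt.hasLineDerivAt e
  exact HasDerivAt.unique h2 h

theorem isOpen_quatQuad_ne (ζ : ℂ) : IsOpen {q | quatQuad ζ q ≠ 0} :=
  isOpen_ne_fun (contDiff_quatQuad_right 0 ζ).continuous continuous_const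

/-- Write `Q` for `quatQuad ζ`. The second derivative of `1/Q` along `e` is `-∂ₑ²Q/Q² + 2(∂ₑQ)²/Q³`.
Summed over the basis, `∂ₑ²Q` gives 8 and `(∂ₑQ)²` gives `4Q`, so the two terms cancel. The value 8
is where dimension four enters. -/
theorem laplace_quatQuad_inv (c ζ : ℂ) {q : ℍ[ℝ]} (hq : quatQuad ζ q ≠ 0) :
    ∑ i, fderiv ℝ (fderiv ℝ fun q => c * (quatQuad ζ q)⁻¹) q (quatBasis i) (quatBasis i) = 0 := by
  have hQ : ContDiff ℝ 2 (quatQuad ζ) := contDiff_quatQuad_right 2 ζ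
  have hf : ContDiffOn ℝ 2 (fun q => c * (quatQuad ζ q)⁻¹) {q | quatQuad ζ q ≠ 0} :=
    contDiffOn_const.mul (hQ.contDiffOn.inv fun q hq => hq)
  have hO := isOpen_quatQuad_ne ζ
  have hf' : ContDiffOn ℝ 1 (fderiv ℝ fun q => c * (quatQuad ζ q)⁻¹) {q | quatQuad ζ q ≠ 0} :=
    hf.fderiv_of_isOpen hO (by norm_num)
  have h1 : ∀ e : ℍ[ℝ], ∀ p ∈ {q | quatQuad ζ q ≠ 0},
      fderiv ℝ (fun q => c * (quatQuad ζ q)⁻¹) p e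
        = c * (-quatQuadPolar ζ p e / quatQuad ζ p ^ 2) := by
    intro e p hp
    refine fderiv_apply_of_line ((hf.contDiffAt (hO.mem_nhds hp)).differentiableAt (by norm_num)) ?_
    have := ((hasDerivAt_line_polar ζ p e).inv (by simpa using hp)).const_mul c
    simpa using this
  have h2 : ∀ e : ℍ[ℝ], fderiv ℝ (fderiv ℝ fun q => c * (quatQuad ζ q)⁻¹) q e e
      = c * (-((2 * (e.re ^ 2 + e.imI ^ 2 + e.imJ ^ 2 + e.imK ^ 2) : ℝ) : ℂ) / quatQuad ζ q ^ 2
        + 2 * quatQuadPolar ζ q e ^ 2 / quatQuad ζ q ^ 3) := by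
    intro e
    have hd : DifferentiableAt ℝ (fderiv ℝ fun q => c * (quatQuad ζ q)⁻¹) q :=
      (hf'.contDiffAt (hO.mem_nhds hq)).differentiableAt (by norm_num)
    have e1 : fderiv ℝ (fderiv ℝ fun q => c * (quatQuad ζ q)⁻¹) q e e
        = fderiv ℝ (fun p => fderiv ℝ (fun q => c * (quatQuad ζ q)⁻¹) p e) q e := by
      rw [fderiv_clm_apply hd (by fun_prop)]
      simp
    rw [e1, Filter.EventuallyEq.fderiv_eq (f := fun p => c * (-quatQuadPolar ζ p e / quatQuad ζ p ^ 2))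
      (by filter_upwards [hO.mem_nhds hq] with p hp using h1 e p hp)]
    have hD : DifferentiableAt ℝ (fun p => c * (-quatQuadPolar ζ p e / quatQuad ζ p ^ 2)) q := by
      refine DifferentiableAt.congr_of_eventuallyEq (f := fun p => fderiv ℝ (fun q => c * (quatQuad ζ q)⁻¹) p e) (hd.clm_apply (by fun_prop)) ?_
      filter_upwards [hO.mem_nhds hq] with p hp using (h1 e p hp).symm
    refine fderiv_apply_of_line hD ?_
    have := (((hasDerivAt_line_polar' ζ q e).neg).div ((hasDerivAt_line_polar ζ q e).pow 2)
      (by simpa using hq)).const_mul c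
    refine this.congr_deriv ?_
    simp only [Pi.pow_apply, Pi.neg_apply, zero_smul, add_zero]
    push_cast
    field_simp
    ring
  simp only [h2]
  simp [Fin.sum_univ_four, quatQuadPolar, quatBasis_re, quatBasis_imI, quatBasis_imJ, quatBasis_imK]
  field_simp
  simp [quatQuad]
  ring_nf
  simp

/-! ### The spherical derivative of a holomorphic function as a contour integral. -/

section Cauchy
open Complex Metric Real

theorem spherical_quad_eq (ζ w : ℂ) :
    (ζ - w.re) ^ 2 + (w.im : ℂ) ^ 2 = (ζ - w) * (ζ - starRingEnd ℂ w) := by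
  have h1 : w = w.re + w.im * I := (re_add_im w).symm
  have h2 : starRingEnd ℂ w = w.re - w.im * I := by
    apply Complex.ext <;> simp
  rw [h2]
  conv_rhs => rw [h1]
  simp only [add_re, ofReal_re, mul_re, I_re, mul_zero, ofReal_im, I_im, mul_one, sub_self,
    add_zero, add_im, mul_im, zero_add]
  linear_combination (w.im : ℂ) ^ 2 * I_sq

/-- Partial fractions: the kernel is `1/((ζ - w)(ζ - w̄))`, and `w - w̄ = 2 i Im w`. -/
theorem integral_spherical_kernel {φ : ℂ → ℂ} {c w : ℂ} {r : ℝ}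
    (hφ : ContinuousOn φ (sphere c r)) (hr : 0 < r) (hw : w.im ≠ 0)
    (h1 : ∀ ζ ∈ sphere c r, ζ ≠ w) (h2 : ∀ ζ ∈ sphere c r, ζ ≠ starRingEnd ℂ w) :
    (∮ ζ in C(c, r), ((ζ - w.re) ^ 2 + (w.im : ℂ) ^ 2)⁻¹ * φ ζ)
      = (2 * w.im * I)⁻¹ * ((∮ ζ in C(c, r), (ζ - w)⁻¹ • φ ζ)
        - ∮ ζ in C(c, r), (ζ - starRingEnd ℂ w)⁻¹ • φ ζ) := by
  have hi : ∀ v : ℂ, (∀ ζ ∈ sphere c r, ζ ≠ v) → CircleIntegrable (fun ζ => (ζ - v)⁻¹ • φ ζ) c r :=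
    fun v hv => ContinuousOn.circleIntegrable hr.le
      (((continuousOn_id.sub continuousOn_const).inv₀ fun ζ hζ => sub_ne_zero.2 (hv ζ hζ)).smul hφ)
  rw [← circleIntegral.integral_sub (hi w h1) (hi _ h2), ← circleIntegral.integral_const_mul]
  refine circleIntegral.integral_congr hr.le fun ζ hζ => ?_
  have e1 := sub_ne_zero.2 (h1 ζ hζ)
  have e2 := sub_ne_zero.2 (h2 ζ hζ)
  have e3 : (2 * w.im * I : ℂ) ≠ 0 := by simp [hw]
  have e4 : (ζ - starRingEnd ℂ w) - (ζ - w) = 2 * w.im * I := by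
    apply Complex.ext <;> simp
    ring
  simp only [spherical_quad_eq, smul_eq_mul]
  rw [← e4] at e3 ⊢
  field_simp

theorem ne_of_mem_sphere_of_mem_ball {c ζ w : ℂ} {r : ℝ} (hζ : ζ ∈ sphere c r)
    (hw : w ∈ ball c r) : ζ ≠ w := by
  rintro rfl
  simp only [mem_sphere, mem_ball] at hζ hw
  exact hw.ne hζ

theorem conj_mem_ball {c w : ℂ} {r : ℝ} (hc : c.im = 0) (hw : w ∈ ball c r) :
    starRingEnd ℂ w ∈ ball c r := by
  have h : starRingEnd ℂ c = c := conj_eq_iff_im.2 hc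
  rw [mem_ball, ← h, dist_conj_conj]
  exact hw

theorem conj_ne_of_mem_closedBall {c ζ w : ℂ} {r : ℝ} (hr : r < |c.im|) (hw : w ∈ ball c r)
    (hζ : ζ ∈ closedBall c r) : ζ ≠ starRingEnd ℂ w := by
  intro h
  have h1 : |ζ.im - c.im| ≤ r := by
    rw [mem_closedBall, Complex.dist_eq] at hζ
    simpa using (abs_im_le_norm (ζ - c)).trans hζ
  have h2 : |w.im - c.im| < r := by
    rw [mem_ball, Complex.dist_eq] at hw
    simpa using (abs_im_le_norm (w - c)).trans_lt hw
  have h3 : ζ.im = -w.im := by rw [h]; simp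
  rw [h3, abs_le] at h1
  rw [abs_lt] at h2
  rcases lt_abs.1 hr with h | h <;> linarith

theorem im_ne_zero_of_mem_ball {c w : ℂ} {r : ℝ} (hr : r < |c.im|) (hw : w ∈ ball c r) :
    w.im ≠ 0 := fun h =>
  conj_ne_of_mem_closedBall hr hw (ball_subset_closedBall hw) (conj_eq_iff_im.2 h).symm

/-- The spherical derivative of the real stem function with holomorphic representative `φ`. -/
def complexSphDeriv (φ : ℂ → ℂ) (w : ℂ) : ℝ :=
  if w.im = 0 then (deriv φ w).re else (φ w).im / w.im

/-- A disc with real centre contains `w̄` together with `w`, so Cauchy's formula produces `(φ(w) -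
φ(w̄)) / (2 i Im w)`, which is `Im φ(w) / Im w` by the symmetry of `φ`. For real `w` the kernel
becomes `(ζ - w)⁻²` and gives `φ'(w)`. -/
theorem complexSphDeriv_eq_of_real_center {φ : ℂ → ℂ} {U : Set ℂ} (hU : IsOpen U)
    (hφ : DifferentiableOn ℂ φ U) (hconj : ∀ w ∈ U, φ (starRingEnd ℂ w) = starRingEnd ℂ (φ w))
    {c w : ℂ} {r : ℝ} (hc : c.im = 0) (hr : 0 < r) (hsub : closedBall c r ⊆ U)
    (hw : w ∈ ball c r) :
    complexSphDeriv φ w = ((2 * π * I : ℂ)⁻¹ *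
      ∮ ζ in C(c, r), ((ζ - w.re) ^ 2 + (w.im : ℂ) ^ 2)⁻¹ * φ ζ).re := by
  rw [complexSphDeriv]
  split_ifs with h
  · have hw' : (w.re : ℂ) = w := by apply Complex.ext <;> simp [h]
    rw [← two_pi_I_inv_smul_circleIntegral_sub_sq_inv_smul_of_differentiable hU hsub hφ hw]
    simp [h, hw']
  · have hd : DiffContOnCl ℂ φ (ball c r) := hφ.diffContOnCl_ball hsub
    have hw2 := conj_mem_ball hc hw
    rw [integral_spherical_kernel (hφ.continuousOn.mono (sphere_subset_closedBall.trans hsub)) hr h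
      (fun ζ hζ => ne_of_mem_sphere_of_mem_ball hζ hw)
      (fun ζ hζ => ne_of_mem_sphere_of_mem_ball hζ hw2),
      hd.circleIntegral_sub_inv_smul hw, hd.circleIntegral_sub_inv_smul hw2,
      hconj w (hsub (ball_subset_closedBall hw))]
    have e : φ w - starRingEnd ℂ (φ w) = 2 * (φ w).im * I := by
      apply Complex.ext <;> simp
      ring
    have e3 : (w.im : ℂ) ≠ 0 := by simp [h]
    have : (2 * π * I : ℂ)⁻¹ * ((2 * w.im * I)⁻¹ * ((2 * π * I : ℂ) • φ w
        - (2 * π * I : ℂ) • starRingEnd ℂ (φ w))) = (((φ w).im / w.im : ℝ) : ℂ) := by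
      rw [← smul_sub, e, smul_eq_mul]
      have := Complex.two_pi_I_ne_zero
      push_cast
      field_simp
    rw [this, ofReal_re]

/-- Here the disc misses the real axis, so `w̄` lies outside it and its term vanishes by Cauchy's
theorem. What remains is `φ(w) / (2 i Im w)`; the factor 2 and the real part turn it into `Im φ(w) /
Im w`. -/
theorem complexSphDeriv_eq_of_nonreal_center {φ : ℂ → ℂ} {U : Set ℂ}
    (hφ : DifferentiableOn ℂ φ U)
    {c w : ℂ} {r : ℝ} (hc : r < |c.im|) (hr : 0 < r) (hsub : closedBall c r ⊆ U)
    (hw : w ∈ ball c r) :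
    complexSphDeriv φ w = (2 * (2 * π * I : ℂ)⁻¹ *
      ∮ ζ in C(c, r), ((ζ - w.re) ^ 2 + (w.im : ℂ) ^ 2)⁻¹ * φ ζ).re := by
  have h := im_ne_zero_of_mem_ball hc hw
  have h0 := fun ζ hζ => conj_ne_of_mem_closedBall (ζ := ζ) hc hw hζ
  have hd : DiffContOnCl ℂ φ (ball c r) := hφ.diffContOnCl_ball hsub
  have hz : (∮ ζ in C(c, r), (ζ - starRingEnd ℂ w)⁻¹ • φ ζ) = 0 := by
    refine DiffContOnCl.circleIntegral_eq_zero hr.le (DifferentiableOn.diffContOnCl_ball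
      (U := closedBall c r) ?_ subset_rfl)
    exact ((differentiableOn_id.sub (differentiableOn_const _)).inv
      fun ζ hζ => sub_ne_zero.2 (h0 ζ hζ)).smul (hφ.mono hsub)
  rw [complexSphDeriv, if_neg h, integral_spherical_kernel
    (hφ.continuousOn.mono (sphere_subset_closedBall.trans hsub)) hr h
    (fun ζ hζ => ne_of_mem_sphere_of_mem_ball hζ hw)
    (fun ζ hζ => h0 ζ (sphere_subset_closedBall hζ)), hz, sub_zero,
    hd.circleIntegral_sub_inv_smul hw]
  have e3 : (w.im : ℂ) ≠ 0 := by simp [h]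
  have : 2 * (2 * π * I : ℂ)⁻¹ * ((2 * w.im * I)⁻¹ * (2 * π * I : ℂ) • φ w)
      = (w.im⁻¹ : ℝ) * (-I * φ w) := by
    rw [smul_eq_mul]
    have := Complex.two_pi_I_ne_zero
    push_cast
    have hI : (-I : ℂ) = I⁻¹ := by simp
    rw [hI]
    field_simp
  rw [this, re_ofReal_mul]
  simp
  ring

theorem quatQuad_eq (ζ : ℂ) (q : ℍ[ℝ]) :
    quatQuad ζ q = (ζ - (toComplex q).re) ^ 2 + ((toComplex q).im : ℂ) ^ 2 := by
  have h : ‖q.im‖ ^ 2 = q.imI ^ 2 + q.imJ ^ 2 + q.imK ^ 2 := by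
    rw [sq, ← Quaternion.normSq_eq_norm_mul_self, Quaternion.normSq_def']
    simp
  rw [quatQuad, ← h]
  simp [toComplex]

theorem continuous_toComplex : Continuous toComplex := by
  have h : toComplex = fun q => (q.re : ℂ) + (‖q.im‖ : ℂ) * I := by
    funext q
    apply Complex.ext <;> simp [toComplex]
  rw [h]
  have := Quaternion.continuous_re
  have := Quaternion.continuous_im
  fun_prop

theorem exists_ball_complexSphDeriv {φ : ℂ → ℂ} {U : Set ℂ} (hU : IsOpen U)
    (hφ : DifferentiableOn ℂ φ U) (hconj : ∀ w ∈ U, φ (starRingEnd ℂ w) = starRingEnd ℂ (φ w))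
    {c : ℂ} (hc : c ∈ U) :
    ∃ r > 0, closedBall c r ⊆ U ∧
      (∀ w ∈ ball c r, ∀ ζ ∈ sphere c r, (ζ - w.re) ^ 2 + (w.im : ℂ) ^ 2 ≠ 0) ∧
      ∃ κ : ℂ, ∀ w ∈ ball c r, complexSphDeriv φ w = (κ *
        ∮ ζ in C(c, r), ((ζ - w.re) ^ 2 + (w.im : ℂ) ^ 2)⁻¹ * φ ζ).re := by
  obtain ⟨r, hr, hrU⟩ := Metric.nhds_basis_closedBall.mem_iff.1 (hU.mem_nhds hc)
  by_cases h : c.im = 0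
  · refine ⟨r, hr, hrU, fun w hw ζ hζ => ?_, (2 * π * I : ℂ)⁻¹, fun w hw =>
      complexSphDeriv_eq_of_real_center hU hφ hconj h hr hrU hw⟩
    rw [spherical_quad_eq]
    exact mul_ne_zero (sub_ne_zero.2 (ne_of_mem_sphere_of_mem_ball hζ hw))
      (sub_ne_zero.2 (ne_of_mem_sphere_of_mem_ball hζ (conj_mem_ball h hw)))
  · have h' : 0 < |c.im| := abs_pos.2 h
    -- Halving `|Im c|` keeps the closed disc off the real axis, hence disjoint from the conjugates
    -- of its interior points.
    have hρ : 0 < min r (|c.im| / 2) := by positivity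
    have hρ2 : min r (|c.im| / 2) < |c.im| := (min_le_right _ _).trans_lt (by linarith)
    have hs : closedBall c (min r (|c.im| / 2)) ⊆ U :=
      (closedBall_subset_closedBall (min_le_left _ _)).trans hrU
    refine ⟨min r (|c.im| / 2), hρ, hs, fun w hw ζ hζ => ?_, 2 * (2 * π * I : ℂ)⁻¹, fun w hw =>
      complexSphDeriv_eq_of_nonreal_center hφ hρ2 hρ hs hw⟩
    rw [spherical_quad_eq]
    exact mul_ne_zero (sub_ne_zero.2 (ne_of_mem_sphere_of_mem_ball hζ hw))
      (sub_ne_zero.2 (conj_ne_of_mem_closedBall hρ2 hw (sphere_subset_closedBall hζ)))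

theorem contDiff_circleMap_real (c : ℂ) (r : ℝ) (k : WithTop ℕ∞) :
    ContDiff ℝ k (circleMap c r) := contDiff_circleMap c r

/-- At `w = toComplex q` the kernel equals `(quatQuad ζ q)⁻¹`, which is harmonic in `q` for each
fixed `ζ` on the circle. The circle is fixed near `q`, so integration preserves harmonicity, also at
real `q`. -/
theorem harmonicAt_complexSphDeriv {φ : ℂ → ℂ} {U : Set ℂ} (hU : IsOpen U)
    (hφ : DifferentiableOn ℂ φ U) (hconj : ∀ w ∈ U, φ (starRingEnd ℂ w) = starRingEnd ℂ (φ w))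
    {q : ℍ[ℝ]} (hq : toComplex q ∈ U) :
    InnerProductSpace.HarmonicAt (fun q => complexSphDeriv φ (toComplex q)) q := by
  obtain ⟨r, hr, hrU, hne, κ, hκ⟩ := exists_ball_complexSphDeriv hU hφ hconj hq
  set c := toComplex q
  have hV : IsOpen (toComplex ⁻¹' ball c r) := isOpen_ball.preimage continuous_toComplex
  have hqV : q ∈ toComplex ⁻¹' ball c r := mem_ball_self hr
  let Φ : ℍ[ℝ] → ℝ → ℂ := fun p θ =>
    (deriv (circleMap c r) θ * φ (circleMap c r θ)) * (quatQuad (circleMap c r θ) p)⁻¹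
  have hmem : ∀ θ, circleMap c r θ ∈ sphere c r := fun θ => circleMap_mem_sphere c hr.le θ
  have hφ2 : ContDiffOn ℝ 2 φ U := (hφ.contDiffOn (n := 2) hU).restrict_scalars ℝ
  have hmap := contDiff_circleMap_real c r 2
  have hΦ : ContDiffOn ℝ 2 (Function.uncurry Φ) ((toComplex ⁻¹' ball c r) ×ˢ Set.univ) := by
    have h1 : ContDiff ℝ 2 fun p : ℍ[ℝ] × ℝ => deriv (circleMap c r) p.2 := by
      simp only [deriv_circleMap]
      exact ((contDiff_circleMap_real 0 r 2).comp contDiff_snd).mul contDiff_const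
    have h2 : ContDiff ℝ 2 fun p : ℍ[ℝ] × ℝ => φ (circleMap c r p.2) :=
      contDiffOn_univ.1 (hφ2.comp (hmap.comp contDiff_snd).contDiffOn
        fun p _ => hrU (sphere_subset_closedBall (hmem p.2)))
    have h3 : ContDiff ℝ 2 fun p : ℍ[ℝ] × ℝ => quatQuad (circleMap c r p.2) p.1 :=
      ContDiff.comp (g := fun p : ℍ[ℝ] × ℂ => quatQuad p.2 p.1)
        (f := fun p : ℍ[ℝ] × ℝ => (p.1, circleMap c r p.2))
        (contDiff_quatQuad 2) (contDiff_fst.prodMk (hmap.comp contDiff_snd))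
    refine (h1.mul h2).contDiffOn.mul (h3.contDiffOn.inv ?_)
    rintro ⟨p, θ⟩ ⟨hp, -⟩
    rw [quatQuad_eq]
    exact hne _ hp _ (hmem θ)
  have hharm := harmonicOnNhd_integral quatBasis hV hΦ (fun θ p hp => laplace_quatQuad_inv _ _ (by
    rw [quatQuad_eq]
    exact hne _ hp _ (hmem θ))) 0 (2 * π) q hqV
  -- Multiplication by `κ` and taking the real part are real-linear, hence preserve harmonicity.
  have h2 := hharm.comp_CLM (Complex.reCLM.comp (κ • ContinuousLinearMap.id ℝ ℂ))
  refine (InnerProductSpace.harmonicAt_congr_nhds ?_).2 h2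
  filter_upwards [hV.mem_nhds hqV] with p hp
  rw [hκ _ hp]
  simp only [Function.comp, ContinuousLinearMap.comp_apply, reCLM_apply]
  congr 1
  simp only [circleIntegral, Φ, smul_apply, ContinuousLinearMap.id_apply,
    smul_eq_mul]
  congr 2
  funext θ
  rw [quatQuad_eq]
  ring

end Cauchy

/-! ### Reduction of quaternion-valued functions to real-valued ones. -/

/-- A quaternion-valued function is harmonic if its composites with linear functionals are. -/
theorem harmonicAt_of_forall_functional {E : Type} [NormedAddCommGroup E] [InnerProductSpace ℝ E]
    [FiniteDimensional ℝ E] {g : E → ℍ[ℝ]} {x : E}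
    (h : ∀ l : ℍ[ℝ] →L[ℝ] ℝ, InnerProductSpace.HarmonicAt (fun y => l (g y)) x) :
    InnerProductSpace.HarmonicAt g x := by
  have e : g = (fun y => innerSL ℝ (quatBasis 0) (g y) • quatBasis 0)
      + (fun y => innerSL ℝ (quatBasis 1) (g y) • quatBasis 1)
      + (fun y => innerSL ℝ (quatBasis 2) (g y) • quatBasis 2)
      + (fun y => innerSL ℝ (quatBasis 3) (g y) • quatBasis 3) := by
    funext y
    conv_lhs => rw [← quatBasis.sum_repr' (g y), Fin.sum_univ_four]
    rfl
  have key : ∀ i, InnerProductSpace.HarmonicAt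
      (fun y => innerSL ℝ (quatBasis i) (g y) • quatBasis i) x := fun i =>
    (h (innerSL ℝ (quatBasis i))).comp_CLM
      ((ContinuousLinearMap.id ℝ ℝ).smulRight (quatBasis i))
  rw [e]
  exact (((key 0).add (key 1)).add (key 2)).add (key 3)

theorem contDiffAt_of_forall_functional {E : Type} [NormedAddCommGroup E] [NormedSpace ℝ E]
    {g : E → ℍ[ℝ]} {x : E} {k : WithTop ℕ∞}
    (h : ∀ l : ℍ[ℝ] →L[ℝ] ℝ, ContDiffAt ℝ k (fun y => l (g y)) x) : ContDiffAt ℝ k g x := by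
  have e : g = fun y => ∑ i, innerSL ℝ (quatBasis i) (g y) • quatBasis i := by
    funext y
    exact (quatBasis.sum_repr' (g y)).symm
  rw [e]
  exact ContDiffAt.sum fun i _ => (h _).smul contDiffAt_const

variable {n : ℕ}

/-! ### Algebra of stem functions -/

/-- For given `K` and `T`, only `H = K Δ T` satisfies `K Δ H = T`, and `Z_k` has coefficients only
at `∅` and `{k}`; so two terms survive. The minus sign is `e_k² = -1`. Every later computation with
a variable goes through this formula. -/
theorem stemMul_stemVar (k : Fin n) (G : StemMap n) (z : Fin n → ℂ) (T : Finset (Fin n)) :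
    stemMul (stemVar k) G z T = (z k).re • G z T +
      if k ∈ T then (z k).im • G z (T.erase k) else -((z k).im • G z (insert k T)) := by
  have h1 : ∀ (A : Finset (Fin n)) (q : ℍ[ℝ]), (∑ H : Finset (Fin n),
      if symmDiff A H = T then (-1) ^ (H ∩ A).card * (q * G z H) else 0)
      = (-1) ^ (symmDiff A T ∩ A).card * (q * G z (symmDiff A T)) := by
    intro A q
    rw [Finset.sum_eq_single (symmDiff A T)]
    · rw [symmDiff_symmDiff_cancel_left, if_pos rfl]
    · intro H _ hH
      rw [if_neg]
      rintro rfl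
      exact hH (symmDiff_symmDiff_cancel_left A H).symm
    · simp
  unfold stemMul
  simp only [h1]
  have hne : (∅ : Finset (Fin n)) ≠ {k} := (Finset.singleton_ne_empty k).symm
  rw [← Finset.sum_subset (s₁ := {∅, {k}}) (Finset.subset_univ _)]
  · rw [Finset.sum_pair hne]
    congr 1
    · rw [show symmDiff ∅ T = T from bot_symmDiff T]
      simp [stemVar, Quaternion.coe_mul_eq_smul]
    · have hd : symmDiff {k} T = if k ∈ T then T.erase k else insert k T := by
        split_ifs with h
        · ext x
          by_cases hx : x = k
          · subst hx; simp [Finset.mem_symmDiff, h]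
          · simp [Finset.mem_symmDiff, hx]
        · ext x
          by_cases hx : x = k
          · subst hx; simp [Finset.mem_symmDiff, h]
          · simp [Finset.mem_symmDiff, hx]
      rw [hd]
      split_ifs with h
      · simp [stemVar, Quaternion.coe_mul_eq_smul]
      · have : insert k T ∩ {k} = {k} := by simp
        rw [this]
        simp [stemVar, Quaternion.coe_mul_eq_smul]
  · intro A _ hA
    simp only [Finset.mem_insert, Finset.mem_singleton, not_or] at hA
    simp [stemVar, hA.1, hA.2]

theorem sphDeriv_of_mem {h : Fin n} {K : Finset (Fin n)} (hK : h ∈ K) (F : StemMap n)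
    (z : Fin n → ℂ) : sphDeriv h F z K = 0 := by
  simp [sphDeriv, hK]

theorem sphDeriv_of_notMem {h : Fin n} {K : Finset (Fin n)} (hK : h ∉ K) (F : StemMap n)
    (z : Fin n → ℂ) : sphDeriv h F z K = ((z h).im)⁻¹ • F z (insert h K) := by
  simp [sphDeriv, hK]

/-- This and the next two commutation rules make the sorted order in the definitions of the iterated
operations irrelevant, so any variable may be taken last. -/
theorem sphDeriv_comm (h k : Fin n) (F : StemMap n) :
    sphDeriv h (sphDeriv k F) = sphDeriv k (sphDeriv h F) := by
  by_cases hk : h = k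
  · rw [hk]
  funext z K
  by_cases h1 : h ∈ K <;> by_cases h2 : k ∈ K <;>
    simp [sphDeriv, h1, h2, hk, Ne.symm hk, Finset.insert_comm h k, smul_comm ((z h).im)⁻¹]

theorem stemVar_stemMul_comm (h k : Fin n) (F : StemMap n) :
    stemMul (stemVar h) (stemMul (stemVar k) F) = stemMul (stemVar k) (stemMul (stemVar h) F) := by
  by_cases hk : h = k
  · rw [hk]
  funext z K
  have hk' := Ne.symm hk
  by_cases h1 : h ∈ K <;> by_cases h2 : k ∈ K <;>
    simp only [stemMul_stemVar, h1, h2, hk, hk', if_true, if_false, Finset.mem_insert,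
      Finset.mem_erase, ne_eq, not_false_eq_true, and_self, or_self, or_true,
      true_and]
  · rw [Finset.erase_right_comm]
    module
  · rw [Finset.erase_insert_of_ne hk']
    module
  · rw [Finset.erase_insert_of_ne hk]
    module
  · rw [Finset.insert_comm]
    module

theorem sphDeriv_stemVar_stemMul {h k : Fin n} (hk : h ≠ k) (F : StemMap n) :
    sphDeriv h (stemMul (stemVar k) F) = stemMul (stemVar k) (sphDeriv h F) := by
  funext z K
  have hk' := Ne.symm hk
  by_cases h1 : h ∈ K
  · rw [sphDeriv_of_mem h1, stemMul_stemVar, sphDeriv_of_mem h1,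
      sphDeriv_of_mem (Finset.mem_erase.2 ⟨hk, h1⟩), sphDeriv_of_mem (Finset.mem_insert_of_mem h1)]
    simp
  · rw [sphDeriv_of_notMem h1, stemMul_stemVar, stemMul_stemVar, sphDeriv_of_notMem h1,
      sphDeriv_of_notMem (fun hc => h1 (Finset.mem_of_mem_erase hc)),
      sphDeriv_of_notMem (by simp [hk, h1])]
    by_cases h2 : k ∈ K
    · simp only [h2, Finset.mem_insert, or_true, if_true, Finset.erase_insert_of_ne hk]
      module
    · simp only [h2, hk', Finset.mem_insert, or_self, if_false, Finset.insert_comm h k]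
      module

/-- Iterated spherical derivatives along a list of variables. -/
def sphDerivList (l : List (Fin n)) (F : StemMap n) : StemMap n :=
  l.foldl (fun G h => sphDeriv h G) F

/-- Iterated multiplication by the variables in a list. -/
def stemVarMulList (l : List (Fin n)) (F : StemMap n) : StemMap n :=
  l.foldr (fun k G => stemMul (stemVar k) G) F

theorem sphDerivList_perm {l l' : List (Fin n)} (h : l.Perm l') (F : StemMap n) :
    sphDerivList l F = sphDerivList l' F := by
  have : RightCommutative (fun (G : StemMap n) h => sphDeriv h G) :=
    ⟨fun G h k => sphDeriv_comm k h G⟩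
  exact h.foldl_eq F

theorem stemVarMulList_perm {l l' : List (Fin n)} (h : l.Perm l') (F : StemMap n) :
    stemVarMulList l F = stemVarMulList l' F := by
  have : LeftCommutative (fun k (G : StemMap n) => stemMul (stemVar k) G) :=
    ⟨fun h k G => stemVar_stemMul_comm h k G⟩
  exact h.foldr_eq F

theorem sort_insert_perm {a : Fin n} {s : Finset (Fin n)} (ha : a ∉ s) :
    (insert a s).sort.Perm (a :: s.sort) := by
  rw [List.perm_iff_count]
  intro b
  rw [← Multiset.coe_count, ← Multiset.coe_count, ← Multiset.cons_coe, Finset.sort_eq,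
    Finset.sort_eq, Finset.insert_val_of_notMem ha]

theorem sort_insert_perm_concat {a : Fin n} {s : Finset (Fin n)} (ha : a ∉ s) :
    (insert a s).sort.Perm (s.sort ++ [a]) :=
  (sort_insert_perm ha).trans (List.perm_append_singleton a s.sort).symm

theorem sphDerivs_insert {a : Fin n} {s : Finset (Fin n)} (ha : a ∉ s) (F : StemMap n) :
    sphDerivs (insert a s) F = sphDeriv a (sphDerivs s F) := by
  refine (sphDerivList_perm (sort_insert_perm_concat ha) F).trans ?_
  simp [sphDerivList, sphDerivs]

theorem stemVarMul_insert {a : Fin n} {s : Finset (Fin n)} (ha : a ∉ s) (F : StemMap n) :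
    stemVarMul (insert a s) F = stemMul (stemVar a) (stemVarMul s F) :=
  stemVarMulList_perm (sort_insert_perm ha) F

theorem sphDerivList_stemVar_stemMul {l : List (Fin n)} {k : Fin n} (hk : k ∉ l) (F : StemMap n) :
    sphDerivList l (stemMul (stemVar k) F) = stemMul (stemVar k) (sphDerivList l F) := by
  induction l generalizing F with
  | nil => rfl
  | cons a l ih =>
    simp only [List.mem_cons, not_or] at hk
    simp only [sphDerivList, List.foldl_cons] at ih ⊢
    rw [sphDeriv_stemVar_stemMul (Ne.symm hk.1), ih hk.2]

theorem sphDerivList_apply_congr (l : List (Fin n)) {F G : StemMap n} {z : Fin n → ℂ}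
    (h : F z = G z) : sphDerivList l F z = sphDerivList l G z := by
  induction l generalizing F G with
  | nil => exact h
  | cons a l ih =>
    refine ih (F := sphDeriv a F) (G := sphDeriv a G) ?_
    funext K
    simp [sphDeriv, h]

/-- The set `s` records the variables already differentiated. A later spherical derivative only
reads coefficients at larger index sets, so vanishing on sets meeting `s` persists while `s` grows
along the list. -/
theorem sphDerivList_eq_zero (l : List (Fin n)) {F : StemMap n} {s : Set (Fin n)}
    (hF : ∀ z T, (∃ h ∈ T, h ∈ s) → F z T = 0) (z : Fin n → ℂ) (T : Finset (Fin n))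
    (h : ∃ h ∈ T, h ∈ l ∨ h ∈ s) : sphDerivList l F z T = 0 := by
  induction l generalizing F s with
  | nil => exact hF z T (by simpa using h)
  | cons a l ih =>
    refine ih (F := sphDeriv a F) (s := insert a s) ?_ ?_
    · rintro z T ⟨b, hb, rfl | hb'⟩
      · exact sphDeriv_of_mem hb _ _
      · by_cases haT : a ∈ T
        · exact sphDeriv_of_mem haT _ _
        · rw [sphDeriv_of_notMem haT, hF z _ ⟨b, Finset.mem_insert_of_mem hb, hb'⟩, smul_zero]
    · obtain ⟨b, hb, hb'⟩ := h
      refine ⟨b, hb, ?_⟩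
      simp only [List.mem_cons, Set.mem_insert_iff] at hb' ⊢
      tauto

theorem sphDerivs_eq_zero (H : Finset (Fin n)) (F : StemMap n) (z : Fin n → ℂ)
    {T : Finset (Fin n)} {h : Fin n} (hT : h ∈ T) (hH : h ∈ H) : sphDerivs H F z T = 0 :=
  sphDerivList_eq_zero (H.sort (· ≤ ·)) (F := F) (s := ∅) (by simp) z T
    ⟨h, hT, Or.inl ((Finset.mem_sort _).2 hH)⟩

/-! ### Stem functions -/

theorem conjAt_apply_same (h : Fin n) (z : Fin n → ℂ) :
    conjAt h z h = starRingEnd ℂ (z h) := by simp [conjAt]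

theorem conjAt_apply_ne {h k : Fin n} (hk : k ≠ h) (z : Fin n → ℂ) :
    conjAt h z k = z k := by simp [conjAt, hk]

theorem IsStem.conj_of_mem {D : Set (Fin n → ℂ)} {F : StemMap n} (hF : IsStem D F) {h : Fin n}
    {z : Fin n → ℂ} (hz : z ∈ D) {K : Finset (Fin n)} (hK : h ∈ K) :
    F (conjAt h z) K = -F z K := by
  rw [hF.conj_eq h z hz K, Finset.inter_singleton_of_mem hK]
  simp

theorem IsStem.conj_of_notMem {D : Set (Fin n → ℂ)} {F : StemMap n} (hF : IsStem D F) {h : Fin n}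
    {z : Fin n → ℂ} (hz : z ∈ D) {K : Finset (Fin n)} (hK : h ∉ K) :
    F (conjAt h z) K = F z K := by
  rw [hF.conj_eq h z hz K, Finset.inter_singleton_of_notMem hK]
  simp

theorem isStem_of {D : Set (Fin n → ℂ)} {F : StemMap n} (hD : ∀ h, ∀ z ∈ D, conjAt h z ∈ D)
    (h1 : ∀ h, ∀ z ∈ D, ∀ K, h ∈ K → F (conjAt h z) K = -F z K)
    (h2 : ∀ h, ∀ z ∈ D, ∀ K, h ∉ K → F (conjAt h z) K = F z K) : IsStem D F := by
  refine ⟨hD, fun h z hz K => ?_⟩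
  by_cases hK : h ∈ K
  · rw [h1 h z hz K hK, Finset.inter_singleton_of_mem hK]
    simp
  · rw [h2 h z hz K hK, Finset.inter_singleton_of_notMem hK]
    simp

/-- Conjugating `z_h` fixes `z` and changes the sign of the coefficient. -/
theorem IsStem.eq_zero {D : Set (Fin n → ℂ)} {F : StemMap n} (hF : IsStem D F) {h : Fin n}
    {z : Fin n → ℂ} (hz : z ∈ D) {K : Finset (Fin n)} (hK : h ∈ K) (h0 : (z h).im = 0) :
    F z K = 0 := by
  have h1 := hF.conj_of_mem hz hK
  have h2 : conjAt h z = z := by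
    rw [conjAt, Complex.conj_eq_iff_im.2 h0, Function.update_eq_self]
  rw [h2] at h1
  have h3 : (2 : ℝ) • F z K = 0 := by
    rw [two_smul]
    nth_rewrite 2 [h1]
    exact add_neg_cancel _
  exact (smul_eq_zero.1 h3).resolve_left two_ne_zero

theorem IsStem.stemVar_stemMul {D : Set (Fin n → ℂ)} {F : StemMap n} (hF : IsStem D F)
    (k : Fin n) : IsStem D (stemMul (stemVar k) F) := by
  refine isStem_of hF.conj_mem (fun h z hz K hK => ?_) (fun h z hz K hK => ?_)
  · rw [stemMul_stemVar, stemMul_stemVar, hF.conj_of_mem hz hK]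
    by_cases hk : h = k
    · subst hk
      rw [hF.conj_of_notMem hz (by simp : h ∉ K.erase h)]
      simp only [conjAt_apply_same, hK, if_true, Complex.conj_re, Complex.conj_im]
      module
    · rw [hF.conj_of_mem hz (by simp [hk, hK] : h ∈ K.erase k),
        hF.conj_of_mem hz (by simp [hK] : h ∈ insert k K), conjAt_apply_ne (Ne.symm hk)]
      split_ifs <;> module
  · rw [stemMul_stemVar, stemMul_stemVar, hF.conj_of_notMem hz hK]
    by_cases hk : h = k
    · subst hk
      rw [hF.conj_of_mem hz (by simp : h ∈ insert h K)]
      simp only [conjAt_apply_same, hK, if_false, Complex.conj_re, Complex.conj_im]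
      module
    · rw [hF.conj_of_notMem hz (by simp [hK] : h ∉ K.erase k),
        hF.conj_of_notMem hz (by simp [hk, hK] : h ∉ insert k K), conjAt_apply_ne (Ne.symm hk)]

/-- Both `β_k⁻¹` and `F_{K ∪ {k}}` are odd under conjugation of `z_k`, so their product is even.
With `0⁻¹ = 0` the argument covers real `z_k` as well, so `D` need not be shrunk. -/
theorem IsStem.sphDeriv {D : Set (Fin n → ℂ)} {F : StemMap n} (hF : IsStem D F)
    (k : Fin n) : IsStem D (sphDeriv k F) := by
  refine isStem_of hF.conj_mem (fun h z hz K hK => ?_) (fun h z hz K hK => ?_)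
  · by_cases hkK : k ∈ K
    · rw [sphDeriv_of_mem hkK, sphDeriv_of_mem hkK, neg_zero]
    · have hk : k ≠ h := fun hc => hkK (hc ▸ hK)
      rw [sphDeriv_of_notMem hkK, sphDeriv_of_notMem hkK, hF.conj_of_mem hz
        (Finset.mem_insert_of_mem hK), conjAt_apply_ne hk, smul_neg]
  · by_cases hkK : k ∈ K
    · rw [sphDeriv_of_mem hkK, sphDeriv_of_mem hkK]
    · rw [sphDeriv_of_notMem hkK, sphDeriv_of_notMem hkK]
      by_cases hk : k = h
      · subst hk
        rw [hF.conj_of_mem hz (Finset.mem_insert_self _ _), conjAt_apply_same, Complex.conj_im,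
          inv_neg, neg_smul_neg]
      · rw [hF.conj_of_notMem hz (by simp [hK, Ne.symm hk]), conjAt_apply_ne hk]

theorem IsStem.stemVarMulList {D : Set (Fin n → ℂ)} {F : StemMap n} (hF : IsStem D F)
    (l : List (Fin n)) : IsStem D (stemVarMulList l F) := by
  induction l with
  | nil => exact hF
  | cons a l ih => exact ih.stemVar_stemMul a

theorem IsStem.sphDerivList {D : Set (Fin n → ℂ)} {F : StemMap n} (hF : IsStem D F)
    (l : List (Fin n)) : IsStem D (sphDerivList l F) := by
  induction l generalizing F with
  | nil => exact hF
  | cons a l ih => exact ih (hF.sphDeriv a)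

theorem conjAt_mem_nonrealPart {D : Set (Fin n → ℂ)} (hD : ∀ h, ∀ z ∈ D, conjAt h z ∈ D)
    (H : Finset (Fin n)) (h : Fin n) (z : Fin n → ℂ) (hz : z ∈ nonrealPart H D) :
    conjAt h z ∈ nonrealPart H D := by
  refine ⟨hD h z hz.1, fun k hk => ?_⟩
  by_cases hkh : k = h
  · subst hkh
    simpa [conjAt_apply_same] using hz.2 k hk
  · rw [conjAt_apply_ne hkh]
    exact hz.2 k hk

theorem IsStem.nonrealPart {D : Set (Fin n → ℂ)} {F : StemMap n} (hF : IsStem D F)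
    (H : Finset (Fin n)) : IsStem (nonrealPart H D) F :=
  ⟨conjAt_mem_nonrealPart hF.conj_mem H, fun h z hz => hF.conj_eq h z hz.1⟩

/-! ### Circularizations -/

theorem exists_imagUnit : ∃ J : ℍ[ℝ], J ∈ imagUnits := by
  refine ⟨quatBasis 1, (Quaternion.sq_eq_neg_normSq.2 (by simp [quatBasis_re])).trans ?_⟩
  rw [Quaternion.normSq_eq_norm_mul_self, quatBasis.orthonormal.1 1]
  simp

theorem re_add_unitOf_mul (q : ℍ[ℝ]) :
    ((toComplex q).re : ℍ[ℝ]) + unitOf q * ((toComplex q).im : ℍ[ℝ]) = q := by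
  have h : unitOf q * ((toComplex q).im : ℍ[ℝ]) = q.im := by
    rw [Quaternion.mul_coe_eq_smul, unitOf, smul_smul]
    change (‖q.im‖ * ‖q.im‖⁻¹) • q.im = q.im
    by_cases h0 : ‖q.im‖ = 0
    · rw [norm_eq_zero.1 h0, smul_zero]
    · rw [mul_inv_cancel₀ h0, one_smul]
  rw [h]
  exact Quaternion.re_add_im q

theorem norm_unitOf_le (q : ℍ[ℝ]) : ‖unitOf q‖ ≤ 1 := by
  rw [unitOf, norm_smul, norm_inv, norm_norm]
  exact inv_mul_le_one

theorem unitOf_mem_imagUnits {q : ℍ[ℝ]} (hq : (toComplex q).im ≠ 0) : unitOf q ∈ imagUnits := by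
  have h0 : ‖q.im‖ ≠ 0 := hq
  have h1 : (q.im) ^ 2 = -((‖q.im‖ ^ 2 : ℝ) : ℍ[ℝ]) := by
    rw [Quaternion.sq_eq_neg_normSq.2 (Quaternion.re_im q), Quaternion.normSq_eq_norm_mul_self, sq]
  change unitOf q ^ 2 = -1
  rw [unitOf, smul_pow, h1, smul_neg, Quaternion.smul_coe]
  rw [← mul_pow, inv_mul_cancel₀ h0]
  simp

theorem exists_slicePoint_eq (q : ℍ[ℝ]) : ∃ J ∈ imagUnits, slicePoint J (toComplex q) = q := by
  by_cases h : (toComplex q).im = 0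
  · obtain ⟨J, hJ⟩ := exists_imagUnit
    refine ⟨J, hJ, ?_⟩
    have := re_add_unitOf_mul q
    rw [h] at this
    simpa [slicePoint, h] using this
  · exact ⟨unitOf q, unitOf_mem_imagUnits h, re_add_unitOf_mul q⟩

theorem toComplex_mem_of_conj {D : Set (Fin n → ℂ)} (hD : ∀ h, ∀ z ∈ D, conjAt h z ∈ D)
    {z : Fin n → ℂ} (hz : z ∈ D) : (fun h => (⟨(z h).re, |(z h).im|⟩ : ℂ)) ∈ D :=
  -- The zero map is a stem function on any conjugation-invariant set, so the membership half of
  -- `IsStem.abs_im` applies.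
  (IsStem.abs_im (F := fun _ _ => 0) ⟨hD, by simp⟩ hz ∅).1

theorem mem_circularization_iff {D : Set (Fin n → ℂ)} (hD : ∀ h, ∀ z ∈ D, conjAt h z ∈ D)
    {x : Fin n → ℍ[ℝ]} : x ∈ circularization D ↔ (fun h => toComplex (x h)) ∈ D := by
  constructor
  · rintro ⟨z, hz, J, hJ, hx⟩
    have : (fun h => toComplex (x h)) = fun h => (⟨(z h).re, |(z h).im|⟩ : ℂ) := by
      funext h
      rw [hx h, toComplex_slicePoint (hJ h)]
    rw [this]
    exact toComplex_mem_of_conj hD hz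
  · intro h
    choose J hJ hx using fun h => exists_slicePoint_eq (x h)
    exact ⟨_, h, J, hJ, fun h => (hx h).symm⟩

theorem mem_of_toComplex_slicePoint_mem {D : Set (Fin n → ℂ)}
    (hD : ∀ h, ∀ z ∈ D, conjAt h z ∈ D) {z : Fin n → ℂ}
    (hz : (fun h => (⟨(z h).re, |(z h).im|⟩ : ℂ)) ∈ D) : z ∈ D := by
  have key : ∀ N : Finset (Fin n),
      (fun h => if h ∈ N then z h else (⟨(z h).re, |(z h).im|⟩ : ℂ)) ∈ D := by
    intro N
    induction N using Finset.induction_on with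
    | empty => simpa using hz
    | insert a N ha ih =>
      by_cases h0 : 0 ≤ (z a).im
      · convert ih using 2 with h
        by_cases hh : h = a
        · subst hh
          simp [ha]
          apply Complex.ext <;> simp [abs_of_nonneg h0]
        · simp [hh]
      · convert hD a _ ih using 1
        funext h
        by_cases hh : h = a
        · subst hh
          simp only [Finset.mem_insert_self, if_true, conjAt_apply_same, ha, if_false]
          apply Complex.ext <;> simp [abs_of_neg (not_le.1 h0)]
        · simp [conjAt_apply_ne hh, hh]
  simpa using key Finset.univ

/-- Allows the set witnessing slice regularity to be identified with the given `D`. A point `z` is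
tested through the quaternions `α + Jβ` with one fixed unit `J`. -/
theorem circularization_inj {D D' : Set (Fin n → ℂ)} (hD : ∀ h, ∀ z ∈ D, conjAt h z ∈ D)
    (hD' : ∀ h, ∀ z ∈ D', conjAt h z ∈ D') (h : circularization D = circularization D') :
    D = D' := by
  obtain ⟨J, hJ⟩ := exists_imagUnit
  have key : ∀ {A B : Set (Fin n → ℂ)}, (∀ h, ∀ z ∈ B, conjAt h z ∈ B) →
      circularization A = circularization B → A ⊆ B := by
    intro A B hB hAB z hz
    refine mem_of_toComplex_slicePoint_mem hB ?_
    have h1 : (fun h => slicePoint J (z h)) ∈ circularization B :=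
      hAB ▸ ⟨z, hz, fun _ => J, fun _ => hJ, fun _ => rfl⟩
    rw [mem_circularization_iff hB] at h1
    simpa only [toComplex_slicePoint hJ] using h1
  exact (key hD' h).antisymm (key hD h.symm)

/-! ### Ordered products -/

theorem orderedProd_empty (q : Fin n → ℍ[ℝ]) : orderedProd q ∅ = 1 := by
  simp [orderedProd]

theorem orderedProd_singleton (q : Fin n → ℍ[ℝ]) (a : Fin n) : orderedProd q {a} = q a := by
  simp [orderedProd]

theorem orderedProd_insert_min (q : Fin n → ℍ[ℝ]) {a : Fin n} {s : Finset (Fin n)}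
    (h : ∀ b ∈ s, a < b) : orderedProd q (insert a s) = q a * orderedProd q s := by
  rw [orderedProd, Finset.sort_insert _ (fun b hb => (h b hb).le)
    (fun hc => lt_irrefl _ (h a hc))]
  simp [orderedProd]

theorem orderedProd_insert_max (q : Fin n → ℍ[ℝ]) {a : Fin n} {s : Finset (Fin n)}
    (h : ∀ b ∈ s, b < a) : orderedProd q (insert a s) = orderedProd q s * q a := by
  have ha : a ∉ s := fun hc => lt_irrefl _ (h a hc)
  have e : (insert a s).sort (· ≤ ·) = s.sort (· ≤ ·) ++ [a] := by
    refine List.Perm.eq_of_pairwise (fun x y _ _ => le_antisymm) (Finset.pairwise_sort _ _) ?_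
      (sort_insert_perm_concat ha)
    rw [List.pairwise_append]
    refine ⟨Finset.pairwise_sort _ _, by simp, fun x hx y hy => ?_⟩
    rw [List.mem_singleton.1 hy]
    exact (h x ((Finset.mem_sort _).1 hx)).le
  rw [orderedProd, e]
  simp [orderedProd]

theorem orderedProd_congr {q q' : Fin n → ℍ[ℝ]} {s : Finset (Fin n)} (h : ∀ a ∈ s, q a = q' a) :
    orderedProd q s = orderedProd q' s := by
  unfold orderedProd
  congr 1
  exact List.map_congr_left fun a ha => h a ((Finset.mem_sort _).1 ha)

theorem norm_orderedProd_le {q : Fin n → ℍ[ℝ]} (h : ∀ a, ‖q a‖ ≤ 1) (s : Finset (Fin n)) :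
    ‖orderedProd q s‖ ≤ 1 := by
  unfold orderedProd
  induction s.sort (· ≤ ·) with
  | nil => simp
  | cons a l ih =>
    rw [List.map_cons, List.prod_cons, norm_mul]
    exact mul_le_one₀ (h a) (norm_nonneg _) ih

theorem orderedProd_ne_zero {q : Fin n → ℍ[ℝ]} (h : ∀ a, q a ≠ 0) (s : Finset (Fin n)) :
    orderedProd q s ≠ 0 := by
  unfold orderedProd
  rw [Ne, List.prod_eq_zero_iff]
  simp [h]

/-- Pairs each index set without `j` with the one obtained by adjoining `j`, the two slots on which
all operations in the variable `x_j` act. -/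
theorem sum_univ_eq_sum_erase {M : Type*} [AddCommMonoid M] (j : Fin n) (f : Finset (Fin n) → M) :
    ∑ T, f T = ∑ T ∈ (Finset.univ.erase j).powerset, (f T + f (insert j T)) := by
  rw [Finset.sum_add_distrib, ← Finset.sum_powerset_insert (Finset.notMem_erase j _),
    Finset.insert_erase (Finset.mem_univ j), Finset.powerset_univ]

theorem notMem_of_mem_powerset_erase {j : Fin n} {T : Finset (Fin n)}
    (hT : T ∈ (Finset.univ.erase j).powerset) : j ∉ T := fun hj =>
  Finset.notMem_erase j _ (Finset.mem_powerset.1 hT hj)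

/-! ### The decomposition -/

/-- When all elements of `T` exceed `j`, `u_{T ∪ {j}} = u_j u_T`, and the pair contributes `u_T (P_T
- r Q_T) + u_j s u_T Q_T = u_T P_T - (r - u_j s) u_T Q_T`. Sets `T` with an element below `j`
contribute nothing. Without that vanishing `u_j` could not be pulled out on the left. -/
theorem decomposition_step (u : Fin n → ℍ[ℝ]) (j : Fin n) (r s : ℝ)
    {G P Q : Finset (Fin n) → ℍ[ℝ]} (hG : ∀ T, ∀ h ∈ T, h < j → G T = 0)
    (hP : ∀ T, ∀ h ∈ T, h ≤ j → P T = 0) (hQ : ∀ T, ∀ h ∈ T, h ≤ j → Q T = 0)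
    (h1 : ∀ T, j ∉ T → s • Q T = G (insert j T)) (h2 : ∀ T, j ∉ T → P T = G T + r • Q T) :
    ∑ T, orderedProd u T * G T = ∑ T, orderedProd u T * P T
      - ((r : ℍ[ℝ]) - u j * (s : ℍ[ℝ])) * ∑ T, orderedProd u T * Q T := by
  rw [sum_univ_eq_sum_erase j, sum_univ_eq_sum_erase j (fun T => orderedProd u T * P T),
    sum_univ_eq_sum_erase j (fun T => orderedProd u T * Q T), Finset.mul_sum,
    ← Finset.sum_sub_distrib]
  refine Finset.sum_congr rfl fun T hT => ?_
  have hj := notMem_of_mem_powerset_erase hT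
  rw [hP (insert j T) j (Finset.mem_insert_self _ _) le_rfl,
    hQ (insert j T) j (Finset.mem_insert_self _ _) le_rfl]
  by_cases hlt : ∃ h ∈ T, h < j
  · obtain ⟨h, hhT, hh⟩ := hlt
    rw [hG T h hhT hh, hG _ h (Finset.mem_insert_of_mem hhT) hh, hP T h hhT hh.le,
      hQ T h hhT hh.le]
    simp
  · have hmin : ∀ b ∈ T, j < b := by
      intro b hb
      by_contra hc
      rcases (not_lt.1 hc).lt_or_eq with h | h
      · exact hlt ⟨b, hb, h⟩
      · exact hj (h ▸ hb)
    rw [orderedProd_insert_min u hmin, ← h1 T hj, h2 T hj]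
    simp only [mul_zero, add_zero, sub_mul, mul_add, mul_assoc, Quaternion.coe_mul_eq_smul,
      mul_smul_comm]
    abel

theorem star_eq_sub (q : ℍ[ℝ]) :
    star q = ((toComplex q).re : ℍ[ℝ]) - unitOf q * ((toComplex q).im : ℍ[ℝ]) := by
  have h : unitOf q * ((toComplex q).im : ℍ[ℝ]) = q - ((toComplex q).re : ℍ[ℝ]) :=
    eq_sub_of_add_eq' (re_add_unitOf_mul q)
  rw [h, Quaternion.star_eq_two_re_sub]
  simp only [toComplex, two_mul, Quaternion.coe_add]
  abel

theorem mem_firstVars {m : ℕ} {h : Fin n} : h ∈ firstVars n m ↔ h.val < m := by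
  simp [firstVars]

theorem firstVars_zero : firstVars n 0 = ∅ := by
  ext h
  simp [mem_firstVars]

theorem firstVars_succ {m : ℕ} (hm : m < n) :
    firstVars n (m + 1) = insert ⟨m, hm⟩ (firstVars n m) := by
  ext h
  simp only [Finset.mem_insert, mem_firstVars, Fin.ext_iff]
  omega

theorem notMem_firstVars {m : ℕ} (hm : m < n) : (⟨m, hm⟩ : Fin n) ∉ firstVars n m := by
  simp [mem_firstVars]

/-- Stated for abstract values `a j K T` at one point, with `j` counting the variables already
treated, so that it serves both the components off the real axes and their extensions. -/
theorem decomposition (x : Fin n → ℍ[ℝ]) (a : ℕ → Finset (Fin n) → Finset (Fin n) → ℍ[ℝ])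
    {m : ℕ} (hmn : m ≤ n)
    (h0 : ∀ j ≤ m, ∀ K ⊆ firstVars n j, ∀ T, ∀ h ∈ T, h.val < j → a j K T = 0)
    (h1 : ∀ j, j < m → ∀ hj : j < n, ∀ K ⊆ firstVars n j, ∀ T, (⟨j, hj⟩ : Fin n) ∉ T →
      (toComplex (x ⟨j, hj⟩)).im • a (j + 1) K T = a j K (insert ⟨j, hj⟩ T))
    (h2 : ∀ j, j < m → ∀ hj : j < n, ∀ K ⊆ firstVars n j, ∀ T, (⟨j, hj⟩ : Fin n) ∉ T →
      a (j + 1) (insert ⟨j, hj⟩ K) T = a j K T + (toComplex (x ⟨j, hj⟩)).re • a (j + 1) K T) :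
    ∑ T, orderedProd (fun h => unitOf (x h)) T * a 0 ∅ T
      = ∑ K ∈ (firstVars n m).powerset, (-1) ^ (firstVars n m \ K).card *
          (orderedProd (fun h => star (x h)) (firstVars n m \ K) *
            ∑ T, orderedProd (fun h => unitOf (x h)) T * a m K T) := by
  induction m with
  | zero => simp [firstVars_zero, orderedProd_empty]
  | succ m ih =>
    have hm : m < n := hmn
    rw [ih hm.le (fun j hj => h0 j (hj.trans m.le_succ)) (fun j hj => h1 j (hj.trans m.lt_succ_self))
      (fun j hj => h2 j (hj.trans m.lt_succ_self)), firstVars_succ hm,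
      Finset.sum_powerset_insert (notMem_firstVars hm), ← Finset.sum_add_distrib]
    refine Finset.sum_congr rfl fun K hK => ?_
    have hK := Finset.mem_powerset.1 hK
    have hjK : (⟨m, hm⟩ : Fin n) ∉ K := fun h => notMem_firstVars hm (hK h)
    have hsub : K ⊆ firstVars n (m + 1) := by
      rw [firstVars_succ hm]
      exact hK.trans (Finset.subset_insert _ _)
    have hsub' : insert ⟨m, hm⟩ K ⊆ firstVars n (m + 1) := by
      rw [firstVars_succ hm]
      exact Finset.insert_subset_insert _ hK
    rw [decomposition_step (fun h => unitOf (x h)) ⟨m, hm⟩ (toComplex (x ⟨m, hm⟩)).re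
      (toComplex (x ⟨m, hm⟩)).im (G := a m K) (P := a (m + 1) (insert ⟨m, hm⟩ K))
      (Q := a (m + 1) K) (fun T h hT hh => h0 m m.le_succ K hK T h hT hh)
      (fun T h hT hh => h0 (m + 1) le_rfl _ hsub' T h hT (Nat.lt_succ_of_le hh))
      (fun T h hT hh => h0 (m + 1) le_rfl _ hsub T h hT (Nat.lt_succ_of_le hh))
      (h1 m m.lt_succ_self hm K hK) (h2 m m.lt_succ_self hm K hK)]
    rw [← star_eq_sub]
    have e1 : insert ⟨m, hm⟩ (firstVars n m) \ K = insert ⟨m, hm⟩ (firstVars n m \ K) :=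
      Finset.insert_sdiff_of_notMem _ hjK
    have e2 : insert ⟨m, hm⟩ (firstVars n m) \ insert ⟨m, hm⟩ K = firstVars n m \ K := by
      ext h
      have := notMem_firstVars hm
      by_cases hh : h = ⟨m, hm⟩
      · subst hh; simp [this]
      · simp [hh]
    -- Indices start at 0, so `m` is the new and largest index: its conjugate belongs at the right
    -- end of the ordered product, exactly where the step formula has placed it.
    have hmax : ∀ b ∈ firstVars n m \ K, b < ⟨m, hm⟩ := fun b hb =>
      mem_firstVars.1 (Finset.mem_sdiff.1 hb).1
    rw [e1, e2, orderedProd_insert_max _ hmax, Finset.card_insert_of_notMem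
      (fun hc => notMem_firstVars hm (Finset.mem_sdiff.1 hc).1), pow_succ]
    simp only [mul_sub, mul_assoc, neg_mul, one_mul, mul_neg]
    abel

/-! ### Circular functions and functions that are slice in one variable -/

theorem toComplex_update (y : Fin n → ℍ[ℝ]) (h : Fin n) (q : ℍ[ℝ]) :
    (fun k => toComplex (Function.update y h q k))
      = Function.update (fun k => toComplex (y k)) h (toComplex q) := by
  funext k
  exact Function.apply_update (fun _ => toComplex) y h q k

theorem isSlice_inducedFun {D : Set (Fin n → ℂ)} {G : StemMap n} (hG : IsStem D G) :
    IsSlice (circularization D) (inducedFun G) :=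
  ⟨D, G, hG, rfl, fun _ _ => rfl⟩

/-- Without coefficients on sets containing `h`, the unit of `x_h` never occurs and `x_h` enters
only through `α_h` and `β_h`. -/
theorem isCircularIn_inducedFun {D : Set (Fin n → ℂ)} {G : StemMap n} (hG : IsStem D G)
    {h : Fin n} (h0 : ∀ z ∈ D, ∀ T, h ∈ T → G z T = 0) :
    IsCircularIn (circularization D) h (inducedFun G) := by
  refine ⟨isSlice_inducedFun hG, fun y _ z I hI J hJ hIm _ => ?_⟩
  have e : (fun k => toComplex (Function.update y h (slicePoint I z) k))
      = fun k => toComplex (Function.update y h (slicePoint J z) k) := by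
    rw [toComplex_update, toComplex_update, toComplex_slicePoint hI, toComplex_slicePoint hJ]
  have hz := (mem_circularization_iff hG.conj_mem).1 hIm
  unfold inducedFun
  refine Finset.sum_congr rfl fun T _ => ?_
  by_cases hT : h ∈ T
  · rw [← e, h0 _ hz T hT]
    simp
  · rw [e]
    congr 1
    refine orderedProd_congr fun a ha => ?_
    have : a ≠ h := fun hc => hT (hc ▸ ha)
    simp [this]

/-- Since no index below `j` occurs, the unit of `x_j` is the leftmost factor wherever it appears.
The remaining units are frozen with `y` and are absorbed into the two coefficients of the
one-variable stem function `F₁`. -/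
theorem isSliceIn_inducedFun {D : Set (Fin n → ℂ)} {G : StemMap n} (hG : IsStem D G)
    {j : Fin n} (h0 : ∀ z ∈ D, ∀ T, ∀ h ∈ T, h < j → G z T = 0) :
    IsSliceIn (circularization D) j (inducedFun G) := by
  refine ⟨isSlice_inducedFun hG, fun y _ => ?_⟩
  set w : Fin n → ℂ := fun k => toComplex (y k) with hw
  let D₁ : Set (Fin 1 → ℂ) := {ζ | Function.update w j (ζ 0) ∈ D}
  let F₁ : StemMap 1 := fun ζ K => ∑ T ∈ (Finset.univ.erase j).powerset,
    orderedProd (fun k => unitOf (y k)) T *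
      G (Function.update w j (ζ 0)) (if 0 ∈ K then insert j T else T)
  have hconj : ∀ h : Fin 1, ∀ ζ : Fin 1 → ℂ, Function.update w j (conjAt h ζ 0)
      = conjAt j (Function.update w j (ζ 0)) := by
    intro h ζ
    rw [Subsingleton.elim h 0, conjAt_apply_same, conjAt]
    simp
  have hF₁ : IsStem D₁ F₁ := by
    refine isStem_of (fun h ζ hζ => ?_) (fun h ζ hζ K hK => ?_) (fun h ζ hζ K hK => ?_)
    · change Function.update w j (conjAt h ζ 0) ∈ D
      rw [hconj]
      exact hG.conj_mem j _ hζ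
    · rw [Subsingleton.elim h 0] at hK
      simp only [F₁, hconj, hK, if_true, ← Finset.sum_neg_distrib]
      refine Finset.sum_congr rfl fun T hT => ?_
      rw [hG.conj_of_mem hζ (Finset.mem_insert_self _ _), mul_neg]
    · rw [Subsingleton.elim h 0] at hK
      simp only [F₁, hconj, hK, if_false]
      refine Finset.sum_congr rfl fun T hT => ?_
      rw [hG.conj_of_notMem hζ (notMem_of_mem_powerset_erase hT)]
  have hmem : ∀ x : Fin 1 → ℍ[ℝ], Function.update y j (x 0) ∈ circularization D ↔
      Function.update w j (toComplex (x 0)) ∈ D := by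
    intro x
    rw [mem_circularization_iff hG.conj_mem, toComplex_update]
  refine ⟨D₁, F₁, hF₁, ?_, ?_⟩
  · ext x
    rw [mem_circularization_iff hF₁.conj_mem]
    exact hmem x
  · intro x hx
    have hx' := (hmem x).1 hx
    change inducedFun G (Function.update y j (x 0)) = inducedFun F₁ x
    have huniv : (Finset.univ : Finset (Finset (Fin 1))) = {∅, {0}} := by decide
    have hr : inducedFun F₁ x = F₁ (fun h => toComplex (x h)) ∅
        + unitOf (x 0) * F₁ (fun h => toComplex (x h)) {0} := by
      rw [inducedFun, huniv, Finset.sum_pair (by decide), orderedProd_empty,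
        orderedProd_singleton, one_mul]
    rw [hr, inducedFun, sum_univ_eq_sum_erase j, toComplex_update, ← hw]
    simp only [F₁, Finset.notMem_empty, if_false, Finset.mem_singleton, if_true, Finset.mul_sum,
      ← Finset.sum_add_distrib]
    refine Finset.sum_congr rfl fun T hT => ?_
    have hj := notMem_of_mem_powerset_erase hT
    have e1 : orderedProd (fun h => unitOf (Function.update y j (x 0) h)) T
        = orderedProd (fun k => unitOf (y k)) T := by
      refine orderedProd_congr fun a ha => ?_
      have : a ≠ j := fun hc => hj (hc ▸ ha)
      simp [this]
    rw [e1]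
    congr 1
    by_cases hlt : ∃ h ∈ T, h < j
    · obtain ⟨h, hhT, hh⟩ := hlt
      rw [h0 _ hx' _ h (Finset.mem_insert_of_mem hhT) hh]
      simp
    · have hmin : ∀ b ∈ T, j < b := by
        intro b hb
        by_contra hc
        rcases (not_lt.1 hc).lt_or_eq with h | h
        · exact hlt ⟨b, hb, h⟩
        · exact hj (h ▸ hb)
      rw [orderedProd_insert_min _ hmin, e1, mul_assoc]
      simp

/-! ### Continuity of induced functions -/

theorem continuousAt_unitOf {q : ℍ[ℝ]} (hq : (toComplex q).im ≠ 0) : ContinuousAt unitOf q := by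
  have h0 : ‖q.im‖ ≠ 0 := hq
  have hc := Quaternion.continuous_im.continuousAt (x := q)
  exact (hc.norm.inv₀ h0).smul hc

theorem continuousAt_orderedProd {X : Type*} [TopologicalSpace X] {g : Fin n → X → ℍ[ℝ]} {x : X}
    {s : Finset (Fin n)} (h : ∀ a ∈ s, ContinuousAt (g a) x) :
    ContinuousAt (fun x => orderedProd (fun a => g a x) s) x := by
  have key : ∀ l : List (Fin n), (∀ a ∈ l, ContinuousAt (g a) x) →
      ContinuousAt (fun x => (l.map fun a => g a x).prod) x := by
    intro l
    induction l with
    | nil => intro _; simpa using continuousAt_const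
    | cons a l ih =>
      intro hl
      simp only [List.map_cons, List.prod_cons]
      exact (hl a (by simp)).mul (ih fun b hb => hl b (by simp [hb]))
  exact key _ fun a ha => h a ((Finset.mem_sort _).1 ha)

open Filter Topology in
-- The unit `Im q / |Im q|` has no limit at real `q`. If some `x_h` with `h ∈ K` is real, then `F_K`
-- vanishes there, while the product of units stays bounded by 1, so the term still tends to 0.
theorem continuousOn_inducedFun {D : Set (Fin n → ℂ)} {G : StemMap n} (hG : IsStem D G)
    (hc : ∀ K, ContinuousOn (fun z => G z K) D) :
    ContinuousOn (inducedFun G) (circularization D) := by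
  unfold inducedFun
  refine continuousOn_finsetSum _ fun K _ => ?_
  have hC : Continuous fun x : Fin n → ℍ[ℝ] => fun h => toComplex (x h) :=
    continuous_pi fun h => continuous_toComplex.comp (continuous_apply h)
  have hGc : ContinuousOn (fun x : Fin n → ℍ[ℝ] => G (fun h => toComplex (x h)) K)
      (circularization D) :=
    (hc K).comp hC.continuousOn fun x hx => (mem_circularization_iff hG.conj_mem).1 hx
  intro x hx
  have hxD := (mem_circularization_iff hG.conj_mem).1 hx
  by_cases h0 : ∃ h ∈ K, (toComplex (x h)).im = 0
  · obtain ⟨h, hK, h0⟩ := h0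
    have hz : G (fun h => toComplex (x h)) K = 0 := hG.eq_zero hxD hK h0
    have h1 : Tendsto (fun x : Fin n → ℍ[ℝ] => G (fun h => toComplex (x h)) K)
        (𝓝[circularization D] x) (𝓝 0) := hz ▸ hGc x hx
    rw [ContinuousWithinAt, hz, mul_zero]
    refine squeeze_zero_norm (fun y => ?_) (by simpa using h1.norm)
    rw [norm_mul]
    exact mul_le_of_le_one_left (norm_nonneg _)
      (norm_orderedProd_le (fun a => norm_unitOf_le _) K)
  · push Not at h0
    have hu : ∀ a ∈ K, ContinuousAt (fun y : Fin n → ℍ[ℝ] => unitOf (y a)) x := by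
      intro a ha
      have h1 : ContinuousAt (fun y : Fin n → ℍ[ℝ] => y a) x := continuousAt_apply a x
      exact ContinuousAt.comp (g := unitOf) (continuousAt_unitOf (h0 a ha)) h1
    have hp := continuousAt_orderedProd (g := fun a (y : Fin n → ℍ[ℝ]) => unitOf (y a)) hu
    exact ContinuousWithinAt.mul hp.continuousWithinAt (hGc x hx)

/-! ### Uniqueness of the inducing stem function -/

/-- Orthogonality of the characters of the group `{±1}ⁿ`. -/
theorem sum_signs_mul (K L : Finset (Fin n)) :
    ∑ ε ∈ Fintype.piFinset fun _ : Fin n => ({1, -1} : Finset ℝ),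
      (∏ h ∈ L, ε h) * ∏ h ∈ K, ε h = if K = L then 2 ^ n else 0 := by
  have e : ∀ ε : Fin n → ℝ, (∏ h ∈ L, ε h) * ∏ h ∈ K, ε h
      = ∏ h, (if h ∈ L then ε h else 1) * (if h ∈ K then ε h else 1) := by
    intro ε
    rw [Finset.prod_mul_distrib, Finset.prod_ite_mem, Finset.prod_ite_mem, Finset.univ_inter,
      Finset.univ_inter]
  simp only [e]
  rw [← Finset.prod_univ_sum (fun _ => {1, -1})
    (fun h e => (if h ∈ L then e else 1) * (if h ∈ K then e else 1))]
  have h2 : ∀ h : Fin n, ∑ e ∈ ({1, -1} : Finset ℝ),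
      (if h ∈ L then e else 1) * (if h ∈ K then e else 1) = if h ∈ K ↔ h ∈ L then 2 else 0 := by
    intro h
    rw [Finset.sum_pair (by norm_num)]
    by_cases h1 : h ∈ L <;> by_cases h2 : h ∈ K <;> simp [h1, h2] <;> norm_num
  simp only [h2]
  split_ifs with hKL
  · subst hKL; simp
  · obtain ⟨h, hh⟩ : ∃ h, ¬(h ∈ K ↔ h ∈ L) := by
      by_contra hc
      push Not at hc
      exact hKL (Finset.ext hc)
    exact Finset.prod_eq_zero (Finset.mem_univ h) (by simp [hh])

/-- Evaluating at `J_h = ε_h J` for a fixed unit `J` and all signs `ε`, orthogonality isolates `J_L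
a_L`, and `J_L` is invertible. -/
theorem eq_zero_of_sum_imagUnits {a : Finset (Fin n) → ℍ[ℝ]}
    (h : ∀ J : Fin n → ℍ[ℝ], (∀ k, J k ∈ imagUnits) → ∑ K, orderedProd J K * a K = 0)
    (L : Finset (Fin n)) : a L = 0 := by
  obtain ⟨J, hJ⟩ := exists_imagUnit
  have h1 : ∀ ε ∈ Fintype.piFinset fun _ : Fin n => ({1, -1} : Finset ℝ),
      ∑ K, (∏ h ∈ K, ε h) • (orderedProd (fun _ => J) K * a K) = 0 := by
    intro ε hε
    have hε' : ∀ k, ε k = 1 ∨ ε k = -1 := fun k => by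
      simpa using Fintype.mem_piFinset.1 hε k
    rw [← h (fun k => ε k • J) fun k => ?_]
    · refine Finset.sum_congr rfl fun K _ => ?_
      rw [orderedProd_smul, smul_mul_assoc]
    · have hJ2 : J ^ 2 = -1 := hJ
      rcases hε' k with hk | hk <;> simp [imagUnits, hk, hJ2]
  have h2 : ∑ ε ∈ Fintype.piFinset fun _ : Fin n => ({1, -1} : Finset ℝ),
      (∏ h ∈ L, ε h) • ∑ K, (∏ h ∈ K, ε h) • (orderedProd (fun _ => J) K * a K) = 0 :=
    Finset.sum_eq_zero fun ε hε => by rw [h1 ε hε, smul_zero]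
  simp only [Finset.smul_sum, smul_smul] at h2
  rw [Finset.sum_comm] at h2
  simp only [← Finset.sum_smul, sum_signs_mul, ite_smul, zero_smul, Finset.sum_ite_eq',
    Finset.mem_univ, if_true] at h2
  have h3 := (smul_eq_zero.1 h2).resolve_left (by positivity)
  refine (mul_eq_zero.1 h3).resolve_left (orderedProd_ne_zero (fun _ h0 => ?_) L)
  have hJ2 : J ^ 2 = -1 := hJ
  rw [h0] at hJ2
  simp at hJ2

theorem IsStem.eqOn_of_inducedFun_eqOn {D : Set (Fin n → ℂ)} {F G : StemMap n}
    (hF : IsStem D F) (hG : IsStem D G)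
    (h : Set.EqOn (inducedFun F) (inducedFun G) (circularization D)) : Set.EqOn F G D := by
  intro z hz
  funext K
  refine sub_eq_zero.1 (eq_zero_of_sum_imagUnits (a := fun K => F z K - G z K) (fun J hJ => ?_) K)
  have := h ⟨z, hz, J, hJ, fun _ => rfl⟩
  rw [inducedFun_eq hF hz hJ, inducedFun_eq hG hz hJ] at this
  simp only [mul_sub, Finset.sum_sub_distrib]
  exact sub_eq_zero.2 this

/-! ### Holomorphy in selected variables and the extended spherical derivative. -/

/-- The spherical derivative, extended to the points with real `z_h` by `∂F_{K ∪ {h}}/∂β_h`. -/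
def regDeriv (h : Fin n) (F : StemMap n) : StemMap n :=
  fun z K => if h ∈ K then 0 else if (z h).im = 0 then dBeta h F z (insert h K)
    else ((z h).im)⁻¹ • F z (insert h K)

/-- `F` is a stem function of class `C¹` on `D` with `∂̄_h F = 0` for `h ∈ A`. -/
structure IsHolomorphicIn (D : Set (Fin n → ℂ)) (A : Set (Fin n)) (F : StemMap n) : Prop where
  stem : IsStem D F
  contDiffOn : ∀ K, ContDiffOn ℝ 1 (fun z => F z K) D
  dBar_eq : ∀ h ∈ A, ∀ z ∈ D, dBar h F z = 0

theorem regDeriv_of_mem {h : Fin n} {K : Finset (Fin n)} (hK : h ∈ K) (F : StemMap n)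
    (z : Fin n → ℂ) : regDeriv h F z K = 0 := by
  simp [regDeriv, hK]

theorem regDeriv_eq_sphDeriv {h : Fin n} {z : Fin n → ℂ} (hz : (z h).im ≠ 0) (F : StemMap n) :
    regDeriv h F z = sphDeriv h F z := by
  funext K
  simp [regDeriv, sphDeriv, hz]

/-- These are Cauchy–Riemann equations: `F_T` and `F_{T ∪ {h}}` play the parts of real and imaginary
part in the variable `z_h`. -/
theorem dBar_eq_zero_iff {h : Fin n} {F : StemMap n} {z : Fin n → ℂ} :
    dBar h F z = 0 ↔ ∀ T, h ∉ T → dAlpha h F z T = dBeta h F z (insert h T) ∧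
      dAlpha h F z (insert h T) = -dBeta h F z T := by
  have e1 : ∀ T, h ∉ T → dBar h F z T
      = (1 / 2 : ℝ) • (dAlpha h F z T - dBeta h F z (insert h T)) := by
    intro T hT
    have hd : symmDiff T {h} = insert h T := by
      ext x
      by_cases hx : x = h
      · subst hx; simp [Finset.mem_symmDiff, hT]
      · simp [Finset.mem_symmDiff, hx]
    simp only [dBar, stemJ, hd]
    rw [Finset.inter_singleton_of_mem (Finset.mem_insert_self _ _)]
    simp [sub_eq_add_neg]
  have e2 : ∀ T, h ∉ T → dBar h F z (insert h T)
      = (1 / 2 : ℝ) • (dAlpha h F z (insert h T) + dBeta h F z T) := by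
    intro T hT
    have hd : symmDiff (insert h T) {h} = T := by
      ext x
      by_cases hx : x = h
      · subst hx; simp [Finset.mem_symmDiff, hT]
      · simp [Finset.mem_symmDiff, hx]
    simp only [dBar, stemJ, hd]
    rw [Finset.inter_singleton_of_notMem hT]
    simp
  constructor
  · intro h0 T hT
    have h1 := e1 T hT
    have h2 := e2 T hT
    rw [h0, Pi.zero_apply, eq_comm, smul_eq_zero] at h1 h2
    exact ⟨sub_eq_zero.1 (h1.resolve_left (by norm_num)),
      eq_neg_of_add_eq_zero_left (h2.resolve_left (by norm_num))⟩
  · intro h0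
    funext K
    by_cases hK : h ∈ K
    · have := e2 (K.erase h) (Finset.notMem_erase h K)
      rw [(h0 _ (Finset.notMem_erase h K)).2, Finset.insert_erase hK] at this
      rw [this]
      simp
    · rw [e1 K hK, (h0 K hK).1]
      simp

/-! ### Multiplication by a variable -/

/-- Multiplication by `c.re + e_k c.im` on `ℍ ⊗ ℝ^{2ⁿ}`. -/
def slotMul (k : Fin n) (c : ℂ) (a : Finset (Fin n) → ℍ[ℝ]) : Finset (Fin n) → ℍ[ℝ] :=
  fun T => c.re • a T + if k ∈ T then c.im • a (T.erase k) else -(c.im • a (insert k T))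

theorem hasFDerivAt_slot (k : Fin n) (z : Fin n → ℂ) :
    HasFDerivAt (fun w : Fin n → ℂ => (w k).re)
      (Complex.reCLM.comp (ContinuousLinearMap.proj (R := ℝ) (φ := fun _ : Fin n => ℂ) k)) z ∧
    HasFDerivAt (fun w : Fin n → ℂ => (w k).im)
      (Complex.imCLM.comp (ContinuousLinearMap.proj (R := ℝ) (φ := fun _ : Fin n => ℂ) k)) z :=
  ⟨(Complex.reCLM.comp (ContinuousLinearMap.proj (R := ℝ) (φ := fun _ : Fin n => ℂ) k)).hasFDerivAt,
   (Complex.imCLM.comp (ContinuousLinearMap.proj (R := ℝ) (φ := fun _ : Fin n => ℂ) k)).hasFDerivAt⟩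

theorem fderiv_stemVar_stemMul (k : Fin n) {G : StemMap n} {z : Fin n → ℂ}
    (hG : ∀ K, DifferentiableAt ℝ (fun w => G w K) z) (T : Finset (Fin n)) (v : Fin n → ℂ) :
    fderiv ℝ (fun w => stemMul (stemVar k) G w T) z v
      = slotMul k (v k) (G z) T + slotMul k (z k) (fun K => fderiv ℝ (fun w => G w K) z v) T := by
  obtain ⟨hre, him⟩ := hasFDerivAt_slot k z
  simp only [stemMul_stemVar, slotMul]
  split_ifs with hk
  · have := (hre.smul (hG T).hasFDerivAt).add (him.smul (hG (T.erase k)).hasFDerivAt)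
    refine (congrArg (fun L => L v) this.fderiv).trans ?_
    simp
    abel
  · have := (hre.smul (hG T).hasFDerivAt).add (him.smul (hG (insert k T)).hasFDerivAt).neg
    refine (congrArg (fun L => L v) this.fderiv).trans ?_
    simp
    abel

theorem contDiff_slot (k : Fin n) : ContDiff ℝ 1 (fun w : Fin n → ℂ => (w k).re) ∧
    ContDiff ℝ 1 (fun w : Fin n → ℂ => (w k).im) :=
  ⟨(Complex.reCLM.comp (ContinuousLinearMap.proj (R := ℝ) (φ := fun _ : Fin n => ℂ) k)).contDiff,
   (Complex.imCLM.comp (ContinuousLinearMap.proj (R := ℝ) (φ := fun _ : Fin n => ℂ) k)).contDiff⟩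

/-- By the Leibniz rule there are two terms. The one differentiating `Z_k` is present only for `k =
h`, where `Z_h` itself satisfies the Cauchy–Riemann equations; the other inherits them from `F`. -/
theorem IsHolomorphicIn.stemVar_stemMul {D : Set (Fin n → ℂ)} (hD : IsOpen D) {A : Set (Fin n)}
    {F : StemMap n} (hF : IsHolomorphicIn D A F) (k : Fin n) :
    IsHolomorphicIn D A (stemMul (stemVar k) F) := by
  obtain ⟨hre, him⟩ := contDiff_slot k
  refine ⟨hF.stem.stemVar_stemMul k, fun K => ?_, fun h hA z hz => ?_⟩
  · simp only [stemMul_stemVar]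
    split_ifs
    · exact (hre.contDiffOn.smul (hF.contDiffOn _)).add (him.contDiffOn.smul (hF.contDiffOn _))
    · exact (hre.contDiffOn.smul (hF.contDiffOn _)).add (him.contDiffOn.smul (hF.contDiffOn _)).neg
  · have hd : ∀ K, DifferentiableAt ℝ (fun w => F w K) z := fun K =>
      ((hF.contDiffOn K).contDiffAt (hD.mem_nhds hz)).differentiableAt (by norm_num)
    have hCR := dBar_eq_zero_iff.1 (hF.dBar_eq h hA z hz)
    have hα : ∀ T, dAlpha h (stemMul (stemVar k) F) z T
        = slotMul k ((Pi.single h 1 : Fin n → ℂ) k) (F z) T + slotMul k (z k) (dAlpha h F z) T :=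
      fun T => fderiv_stemVar_stemMul k hd T _
    have hβ : ∀ T, dBeta h (stemMul (stemVar k) F) z T
        = slotMul k ((Pi.single h Complex.I : Fin n → ℂ) k) (F z) T
          + slotMul k (z k) (dBeta h F z) T :=
      fun T => fderiv_stemVar_stemMul k hd T _
    refine dBar_eq_zero_iff.2 fun T hT => ?_
    rw [hα, hα, hβ, hβ]
    by_cases hk : k = h
    · subst hk
      obtain ⟨c1, c2⟩ := hCR T hT
      simp only [slotMul, Pi.single_eq_same, hT, if_false, Finset.mem_insert_self, if_true,
        Finset.erase_insert hT, c1, c2, Complex.one_re, Complex.one_im, Complex.I_re, Complex.I_im]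
      constructor <;> module
    · obtain ⟨c1, c2⟩ := hCR T hT
      obtain ⟨d1, d2⟩ := hCR (T.erase k) (fun hc => hT (Finset.mem_of_mem_erase hc))
      obtain ⟨f1, f2⟩ := hCR (insert k T) (by simp [hT, Ne.symm hk])
      simp only [slotMul, Pi.single_eq_of_ne hk, Complex.zero_re, Complex.zero_im,
        Finset.mem_insert, hk, false_or, Finset.erase_insert_of_ne (Ne.symm hk),
        Finset.insert_comm k h, c1, c2, d1, d2, f1, f2]
      split_ifs <;> constructor <;> module

theorem IsHolomorphicIn.stemVarMulList {D : Set (Fin n → ℂ)} (hD : IsOpen D) {A : Set (Fin n)}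
    {F : StemMap n} (hF : IsHolomorphicIn D A F) (l : List (Fin n)) :
    IsHolomorphicIn D A (stemVarMulList l F) := by
  induction l with
  | nil => exact hF
  | cons a l ih => exact ih.stemVar_stemMul hD a

/-! ### Density of the non-real points -/

open Filter Topology in
theorem eqOn_of_eqOn_nonrealPart {X : Type*} [TopologicalSpace X] [T2Space X]
    {D : Set (Fin n → ℂ)} (hD : IsOpen D) (H : Finset (Fin n)) {f g : (Fin n → ℂ) → X}
    (hf : ContinuousOn f D) (hg : ContinuousOn g D) (h : Set.EqOn f g (nonrealPart H D)) :
    Set.EqOn f g D := by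
  intro z hz
  -- All coordinates are shifted by `i t` at once: for small `t ≠ 0` the real ones become non-real
  -- and the others remain non-real.
  let p : ℝ → Fin n → ℂ := fun t k => z k + t * Complex.I
  have hp : Continuous p := by
    refine continuous_pi fun k => ?_
    fun_prop
  have hp0 : p 0 = z := by
    funext k
    simp [p]
  have ht : Tendsto p (𝓝[≠] 0) (𝓝 z) := by
    have := hp.tendsto 0
    rw [hp0] at this
    exact this.mono_left nhdsWithin_le_nhds
  have hev : ∀ᶠ t in 𝓝[≠] (0 : ℝ), p t ∈ nonrealPart H D := by
    have h1 : ∀ᶠ t in 𝓝[≠] (0 : ℝ), p t ∈ D := ht (hD.mem_nhds hz)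
    have h2 : ∀ᶠ t in 𝓝[≠] (0 : ℝ), ∀ k ∈ H, (p t k).im ≠ 0 := by
      rw [Finset.eventually_all]
      intro k _
      by_cases h0 : (z k).im = 0
      · filter_upwards [self_mem_nhdsWithin] with t ht
        simpa [p, h0] using ht
      · have : Continuous fun t => (p t k).im := by fun_prop
        have h3 : ∀ᶠ t in 𝓝 (0 : ℝ), (p t k).im ≠ 0 :=
          this.continuousAt.eventually_ne (by rw [hp0]; exact h0)
        exact h3.filter_mono nhdsWithin_le_nhds
    filter_upwards [h1, h2] with t h1 h2 using ⟨h1, h2⟩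
  have hfz : Tendsto (fun t => f (p t)) (𝓝[≠] 0) (𝓝 (f z)) :=
    (hf.continuousAt (hD.mem_nhds hz)).tendsto.comp ht
  have hgz : Tendsto (fun t => g (p t)) (𝓝[≠] 0) (𝓝 (g z)) :=
    (hg.continuousAt (hD.mem_nhds hz)).tendsto.comp ht
  exact tendsto_nhds_unique_of_eventuallyEq hfz hgz (hev.mono fun t ht => h ht)

/-! ### The one-variable holomorphic functions attached to a holomorphic stem function -/

/-- The complex-valued function of `z_h = ζ` with real and imaginary parts the values of the
functional `l` on the coefficients `F_T` and `F_{T ∪ {h}}`. -/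
def slotFun (F : StemMap n) (l : ℍ[ℝ] →L[ℝ] ℝ) (h : Fin n) (T : Finset (Fin n)) (z : Fin n → ℂ)
    (ζ : ℂ) : ℂ :=
  l (F (Function.update z h ζ) T) + l (F (Function.update z h ζ) (insert h T)) * Complex.I

theorem isOpen_slot {D : Set (Fin n → ℂ)} (hD : IsOpen D) (h : Fin n) (z : Fin n → ℂ) :
    IsOpen {ζ | Function.update z h ζ ∈ D} :=
  hD.preimage (continuous_const.update h continuous_id)

theorem hasFDerivAt_slot_update {D : Set (Fin n → ℂ)} (hD : IsOpen D) {A : Set (Fin n)}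
    {F : StemMap n} (hF : IsHolomorphicIn D A F) {h : Fin n} (K : Finset (Fin n))
    {z : Fin n → ℂ} {ζ : ℂ} (hζ : Function.update z h ζ ∈ D) :
    HasFDerivAt (fun ζ => F (Function.update z h ζ) K)
      ((fderiv ℝ (fun w => F w K) (Function.update z h ζ)).comp
        (ContinuousLinearMap.single ℝ (fun _ : Fin n => ℂ) h)) ζ := by
  have h1 : DifferentiableAt ℝ (fun w => F w K) (Function.update z h ζ) :=
    ((hF.contDiffOn K).contDiffAt (hD.mem_nhds hζ)).differentiableAt (by norm_num)
  have e : (ContinuousLinearMap.pi (Pi.single h (ContinuousLinearMap.id ℝ ℂ)) : ℂ →L[ℝ] Fin n → ℂ)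
      = ContinuousLinearMap.single ℝ (fun _ : Fin n => ℂ) h := by
    ext1 c
    funext k
    by_cases hk : k = h
    · subst hk; simp
    · simp [hk]
  rw [← e]
  exact HasFDerivAt.comp (g := fun w => F w K) ζ h1.hasFDerivAt (hasFDerivAt_update z ζ)

theorem hasDerivAt_slotFun {D : Set (Fin n → ℂ)} (hD : IsOpen D) {A : Set (Fin n)}
    {F : StemMap n} (hF : IsHolomorphicIn D A F) (l : ℍ[ℝ] →L[ℝ] ℝ) {h : Fin n} (hA : h ∈ A)
    {T : Finset (Fin n)} (hT : h ∉ T) {z : Fin n → ℂ} {ζ : ℂ}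
    (hζ : Function.update z h ζ ∈ D) :
    HasDerivAt (slotFun F l h T z)
      (l (dAlpha h F (Function.update z h ζ) T)
        + l (dAlpha h F (Function.update z h ζ) (insert h T)) * Complex.I) ζ := by
  obtain ⟨c1, c2⟩ := dBar_eq_zero_iff.1 (hF.dBar_eq h hA _ hζ) T hT
  have hu := Complex.ofRealCLM.hasFDerivAt.comp ζ
    (l.hasFDerivAt.comp ζ (hasFDerivAt_slot_update hD hF T hζ))
  have hv := (Complex.ofRealCLM.hasFDerivAt.comp ζ
    (l.hasFDerivAt.comp ζ (hasFDerivAt_slot_update hD hF (insert h T) hζ))).mul_const Complex.I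
  have hs := hu.add hv
  rw [hasDerivAt_iff_hasFDerivAt]
  refine hasFDerivAt_of_restrictScalars ℝ hs ?_
  have e1 : ∀ K, (fderiv ℝ (fun w => F w K) (Function.update z h ζ))
      (Pi.single h (1 : ℂ)) = dAlpha h F (Function.update z h ζ) K := fun _ => rfl
  have e2 : ∀ K, (fderiv ℝ (fun w => F w K) (Function.update z h ζ))
      (Pi.single h Complex.I) = dBeta h F (Function.update z h ζ) K := fun _ => rfl
  apply ContinuousLinearMap.coe_injective
  -- Complex linearity of the real derivative is checked on `1` and `i`; the value at `i` is
  -- supplied by the Cauchy–Riemann equations.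
  refine Complex.basisOneI.ext fun i => ?_
  fin_cases i
  · simp [e1, mul_comm]
  · simp [e2, c1, c2, mul_add, mul_comm, ← mul_assoc]
    ring

theorem slotFun_conj {D : Set (Fin n → ℂ)} {F : StemMap n} (hF : IsStem D F)
    (l : ℍ[ℝ] →L[ℝ] ℝ) {h : Fin n} {T : Finset (Fin n)} (hT : h ∉ T) {z : Fin n → ℂ} {ζ : ℂ}
    (hζ : Function.update z h ζ ∈ D) :
    slotFun F l h T z (starRingEnd ℂ ζ) = starRingEnd ℂ (slotFun F l h T z ζ) := by
  have e : Function.update z h (starRingEnd ℂ ζ) = conjAt h (Function.update z h ζ) := by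
    simp [conjAt]
  rw [slotFun, e, hF.conj_of_notMem hζ hT, hF.conj_of_mem hζ (Finset.mem_insert_self _ _)]
  simp [slotFun]

theorem differentiableOn_slotFun {D : Set (Fin n → ℂ)} (hD : IsOpen D) {A : Set (Fin n)}
    {F : StemMap n} (hF : IsHolomorphicIn D A F) (l : ℍ[ℝ] →L[ℝ] ℝ) {h : Fin n} (hA : h ∈ A)
    {T : Finset (Fin n)} (hT : h ∉ T) (z : Fin n → ℂ) :
    DifferentiableOn ℂ (slotFun F l h T z) {ζ | Function.update z h ζ ∈ D} := fun _ hζ =>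
  (hasDerivAt_slotFun hD hF l hA hT hζ).differentiableAt.differentiableWithinAt

theorem complexSphDeriv_slotFun {D : Set (Fin n → ℂ)} (hD : IsOpen D) {A : Set (Fin n)}
    {F : StemMap n} (hF : IsHolomorphicIn D A F) (l : ℍ[ℝ] →L[ℝ] ℝ) {h : Fin n} (hA : h ∈ A)
    {T : Finset (Fin n)} (hT : h ∉ T) {z : Fin n → ℂ} {ζ : ℂ}
    (hζ : Function.update z h ζ ∈ D) :
    complexSphDeriv (slotFun F l h T z) ζ = l (regDeriv h F (Function.update z h ζ) T) := by
  obtain ⟨c1, -⟩ := dBar_eq_zero_iff.1 (hF.dBar_eq h hA _ hζ) T hT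
  simp only [complexSphDeriv, regDeriv, hT, if_false, Function.update_self]
  split_ifs with h0
  · rw [(hasDerivAt_slotFun hD hF l hA hT hζ).deriv, c1]
    simp
  · simp [slotFun]
    ring

/-! ### Regularity of the extended spherical derivative -/

open Metric Set in
-- Over a fixed circle about the real point `z₀ h`, the variable `z_h` enters only through the
-- kernel and the others only through `F`. The integrand is thus jointly `C¹`, and dividing by `β_h`
-- costs no derivative.
theorem contDiffAt_regDeriv_of_im_eq_zero {D : Set (Fin n → ℂ)} (hD : IsOpen D)
    {A : Set (Fin n)} {F : StemMap n} (hF : IsHolomorphicIn D A F) {h : Fin n} (hA : h ∈ A)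
    {T : Finset (Fin n)} (hT : h ∉ T) {z₀ : Fin n → ℂ} (hz₀ : z₀ ∈ D) (h0 : (z₀ h).im = 0) :
    ContDiffAt ℝ 1 (fun z => regDeriv h F z T) z₀ := by
  obtain ⟨ρ, hρ, hρD⟩ := Metric.mem_nhds_iff.1 (hD.mem_nhds hz₀)
  -- With half the radius, replacing the `h`-th coordinate by a point of the closed disc stays
  -- inside the ball of radius `ρ` in the sup metric.
  set r := ρ / 2 with hr
  have hr0 : 0 < r := by positivity
  set c := z₀ h
  have hupd : ∀ z ∈ ball z₀ r, ∀ ζ ∈ closedBall c r, Function.update z h ζ ∈ D := by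
    intro z hz ζ hζ
    apply hρD
    rw [mem_ball, dist_pi_lt_iff hρ]
    intro k
    by_cases hk : k = h
    · subst hk
      rw [Function.update_self]
      exact (mem_closedBall.1 hζ).trans_lt (by linarith)
    · rw [Function.update_of_ne hk]
      exact ((dist_le_pi_dist z z₀ k).trans_lt (mem_ball.1 hz)).trans (by linarith)
  have hmem : ∀ z ∈ ball z₀ r, z h ∈ ball c r := fun z hz =>
    (dist_le_pi_dist z z₀ h).trans_lt (mem_ball.1 hz)
  have hsph : ∀ θ, circleMap c r θ ∈ sphere c r := fun θ => circleMap_mem_sphere c hr0.le θ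
  refine contDiffAt_of_forall_functional fun l => ?_
  let Φ : (Fin n → ℂ) → ℝ → ℂ := fun z θ => deriv (circleMap c r) θ *
    (((circleMap c r θ - (z h).re) ^ 2 + ((z h).im : ℂ) ^ 2)⁻¹ *
      slotFun F l h T z (circleMap c r θ))
  have hmap := contDiff_circleMap_real c r 1
  have hmap2 : ContDiff ℝ 1 fun p : (Fin n → ℂ) × ℝ => circleMap c r p.2 :=
    hmap.comp contDiff_snd
  have hΦ : ContDiffOn ℝ 1 (Function.uncurry Φ) (ball z₀ r ×ˢ univ) := by
    have h1 : ContDiff ℝ 1 fun p : (Fin n → ℂ) × ℝ => deriv (circleMap c r) p.2 := by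
      simp only [deriv_circleMap]
      exact ((contDiff_circleMap_real 0 r 1).comp contDiff_snd).mul contDiff_const
    obtain ⟨hre, him⟩ := contDiff_slot h
    have hof : ContDiff ℝ 1 (fun x : ℝ => (x : ℂ)) := Complex.ofRealCLM.contDiff
    have h2 : ContDiff ℝ 1 fun p : (Fin n → ℂ) × ℝ =>
        (circleMap c r p.2 - (p.1 h).re) ^ 2 + ((p.1 h).im : ℂ) ^ 2 :=
      ((hmap2.sub (hof.comp (hre.comp contDiff_fst))).pow 2).add
        ((hof.comp (him.comp contDiff_fst)).pow 2)
    have h3 : ContDiff ℝ 1 fun p : (Fin n → ℂ) × ℝ =>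
        Function.update p.1 h (circleMap c r p.2) := by
      rw [contDiff_pi]
      intro k
      by_cases hk : k = h
      · subst hk
        simpa only [Function.update_self] using hmap2
      · simp only [Function.update_of_ne hk]
        exact (contDiff_apply ℝ ℂ k).comp contDiff_fst
    have h4 : ∀ K, ContDiffOn ℝ 1 (fun p : (Fin n → ℂ) × ℝ =>
        ((l (F (Function.update p.1 h (circleMap c r p.2)) K) : ℝ) : ℂ)) (ball z₀ r ×ˢ univ) := by
      intro K
      have h5 : ContDiffOn ℝ 1 (fun p : (Fin n → ℂ) × ℝ =>
          F (Function.update p.1 h (circleMap c r p.2)) K) (ball z₀ r ×ˢ univ) :=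
        ContDiffOn.comp (g := fun w => F w K) (hF.contDiffOn K) h3.contDiffOn fun p hp =>
          hupd _ hp.1 _ (sphere_subset_closedBall (hsph p.2))
      exact hof.comp_contDiffOn (l.contDiff.comp_contDiffOn h5)
    refine h1.contDiffOn.mul ((h2.contDiffOn.inv ?_).mul
      ((h4 T).add ((h4 (insert h T)).mul contDiffOn_const)))
    rintro ⟨z, θ⟩ ⟨hz, -⟩
    rw [spherical_quad_eq]
    exact mul_ne_zero (sub_ne_zero.2 (ne_of_mem_sphere_of_mem_ball (hsph θ) (hmem z hz)))
      (sub_ne_zero.2 (ne_of_mem_sphere_of_mem_ball (hsph θ) (conj_mem_ball h0 (hmem z hz))))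
  have hI := contDiffOn_integral (Φ := Φ) isOpen_ball 0 (2 * Real.pi) 1 (by exact_mod_cast hΦ)
  have hR : ContDiffOn ℝ 1 (fun z => ((2 * Real.pi * Complex.I : ℂ)⁻¹ *
      ∫ θ in (0 : ℝ)..2 * Real.pi, Φ z θ).re) (ball z₀ r) :=
    Complex.reCLM.contDiff.comp_contDiffOn (contDiffOn_const.mul (by exact_mod_cast hI))
  refine (hR.contDiffAt (isOpen_ball.mem_nhds (mem_ball_self hr0))).congr_of_eventuallyEq ?_
  filter_upwards [isOpen_ball.mem_nhds (mem_ball_self hr0)] with z hz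
  have hzD : Function.update z h (z h) ∈ D := hupd z hz _ (ball_subset_closedBall (hmem z hz))
  have e1 := complexSphDeriv_slotFun hD hF l hA hT hzD
  rw [Function.update_eq_self] at e1
  rw [← e1, complexSphDeriv_eq_of_real_center (isOpen_slot hD h z)
    (differentiableOn_slotFun hD hF l hA hT z) (fun w hw => slotFun_conj hF.stem l hT hw)
    h0 hr0 (fun ζ hζ => hupd z hz ζ hζ) (hmem z hz)]
  simp only [circleIntegral, Φ, smul_eq_mul]

theorem regDeriv_eventuallyEq {h : Fin n} {F : StemMap n} {T : Finset (Fin n)} (hT : h ∉ T)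
    {z₀ : Fin n → ℂ} (h0 : (z₀ h).im ≠ 0) :
    (fun z => regDeriv h F z T) =ᶠ[nhds z₀] fun z => ((z h).im)⁻¹ • F z (insert h T) := by
  have : ∀ᶠ z in nhds z₀, (z h).im ≠ 0 :=
    (contDiff_slot h).2.continuous.continuousAt.eventually_ne h0
  filter_upwards [this] with z hz
  rw [regDeriv_eq_sphDeriv hz, sphDeriv_of_notMem hT]

theorem contDiffOn_regDeriv {D : Set (Fin n → ℂ)} (hD : IsOpen D)
    {A : Set (Fin n)} {F : StemMap n} (hF : IsHolomorphicIn D A F) {h : Fin n} (hA : h ∈ A)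
    (T : Finset (Fin n)) : ContDiffOn ℝ 1 (fun z => regDeriv h F z T) D := by
  intro z hz
  refine ContDiffAt.contDiffWithinAt ?_
  by_cases hT : h ∈ T
  · simp only [regDeriv_of_mem hT]
    exact contDiffAt_const
  by_cases h0 : (z h).im = 0
  · exact contDiffAt_regDeriv_of_im_eq_zero hD hF hA hT hz h0
  · refine ContDiffAt.congr_of_eventuallyEq ?_ (regDeriv_eventuallyEq hT h0)
    exact ((contDiff_slot h).2.contDiffAt.inv h0).smul
      ((hF.contDiffOn _).contDiffAt (hD.mem_nhds hz))

/-- In a direction with `v h = 0` the factor `β_h⁻¹` is constant. -/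
theorem fderiv_regDeriv {D : Set (Fin n → ℂ)} (hD : IsOpen D)
    {A : Set (Fin n)} {F : StemMap n} (hF : IsHolomorphicIn D A F) {h : Fin n}
    {T : Finset (Fin n)} (hT : h ∉ T) {z v : Fin n → ℂ} (hz : z ∈ D) (h0 : (z h).im ≠ 0)
    (hv : v h = 0) :
    fderiv ℝ (fun z => regDeriv h F z T) z v
      = ((z h).im)⁻¹ • fderiv ℝ (fun z => F z (insert h T)) z v := by
  rw [(regDeriv_eventuallyEq hT h0).fderiv_eq]
  have h1 : DifferentiableAt ℝ (fun w => F w (insert h T)) z :=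
    ((hF.contDiffOn _).contDiffAt (hD.mem_nhds hz)).differentiableAt (by norm_num)
  have h2 : HasFDerivAt (fun w : Fin n → ℂ => ((w h).im)⁻¹) _ z :=
    (hasDerivAt_inv h0).comp_hasFDerivAt z (hasFDerivAt_slot h z).2
  refine (congrArg (fun L => L v) (h2.smul h1.hasFDerivAt).fderiv).trans ?_
  simp [hv]

theorem IsHolomorphicIn.continuousOn {D : Set (Fin n → ℂ)} {A : Set (Fin n)} {F : StemMap n}
    (hF : IsHolomorphicIn D A F) (K : Finset (Fin n)) : ContinuousOn (fun z => F z K) D :=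
  (hF.contDiffOn K).continuousOn

theorem continuousOn_fderiv_apply {D : Set (Fin n → ℂ)} (hD : IsOpen D)
    {g : (Fin n → ℂ) → ℍ[ℝ]} (hg : ContDiffOn ℝ 1 g D) (v : Fin n → ℂ) :
    ContinuousOn (fun z => fderiv ℝ g z v) D :=
  (hg.continuousOn_fderiv_of_isOpen hD (by norm_num)).clm_apply continuousOn_const

theorem continuous_conjAt (h : Fin n) : Continuous (conjAt h) :=
  continuous_id.update h (Complex.continuous_conj.comp (continuous_apply h))

theorem isStem_regDeriv {D : Set (Fin n → ℂ)} (hD : IsOpen D)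
    {A : Set (Fin n)} {F : StemMap n} (hF : IsHolomorphicIn D A F) {h : Fin n} (hA : h ∈ A) :
    IsStem D (regDeriv h F) := by
  refine ⟨hF.stem.conj_mem, fun k z hz K => ?_⟩
  have hc := (contDiffOn_regDeriv hD hF hA K).continuousOn
  refine eqOn_of_eqOn_nonrealPart hD {h} (f := fun z => regDeriv h F (conjAt k z) K)
    (g := fun z => (-1) ^ (K ∩ {k}).card * regDeriv h F z K)
    (hc.comp (continuous_conjAt k).continuousOn fun z hz => hF.stem.conj_mem k z hz)
    (continuousOn_const.mul hc) (fun z hz => ?_) hz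
  have h1 := hz.2 h (Finset.mem_singleton_self h)
  have h2 := (conjAt_mem_nonrealPart hF.stem.conj_mem {h} k z hz).2 h (Finset.mem_singleton_self h)
  simp only [regDeriv_eq_sphDeriv h1, regDeriv_eq_sphDeriv h2]
  exact (hF.stem.sphDeriv h).conj_eq k z hz.1 K

/-- Off the real points of `z_h` the Cauchy–Riemann equations in `z_k`, `k ≠ h`, are merely divided
by `β_h`. Both sides are continuous because the extension is `C¹`, so density finishes the proof.
Holomorphy in `z_h` itself is given up, which is why the set `A` shrinks. -/
theorem IsHolomorphicIn.regDeriv {D : Set (Fin n → ℂ)} (hD : IsOpen D)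
    {A : Set (Fin n)} {F : StemMap n} (hF : IsHolomorphicIn D A F) {h : Fin n} (hA : h ∈ A) :
    IsHolomorphicIn D (A \ {h}) (regDeriv h F) := by
  have hC := contDiffOn_regDeriv hD hF hA
  refine ⟨isStem_regDeriv hD hF hA, hC, fun k hk z hz => dBar_eq_zero_iff.2 fun T hT => ?_⟩
  have hkh : h ≠ k := fun hc => hk.2 hc.symm
  have hcα : ∀ T, ContinuousOn (fun z => dAlpha k (SliceH.regDeriv h F) z T) D := fun T =>
    continuousOn_fderiv_apply hD (hC T) _
  have hcβ : ∀ T, ContinuousOn (fun z => dBeta k (SliceH.regDeriv h F) z T) D := fun T =>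
    continuousOn_fderiv_apply hD (hC T) _
  by_cases hhT : h ∈ T
  · have hz0 : ∀ K, h ∈ K → (fun z => SliceH.regDeriv h F z K) = fun _ => 0 := fun K hK =>
      funext fun z => regDeriv_of_mem hK F z
    simp [dAlpha, dBeta, hz0 T hhT, hz0 (insert k T) (Finset.mem_insert_of_mem hhT)]
  have hα : ∀ z ∈ nonrealPart {h} D, ∀ K, h ∉ K → dAlpha k (SliceH.regDeriv h F) z K
      = ((z h).im)⁻¹ • dAlpha k F z (insert h K) := fun z hz K hK =>
    fderiv_regDeriv hD hF hK hz.1 (hz.2 h (Finset.mem_singleton_self h)) (by simp [hkh])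
  have hβ : ∀ z ∈ nonrealPart {h} D, ∀ K, h ∉ K → dBeta k (SliceH.regDeriv h F) z K
      = ((z h).im)⁻¹ • dBeta k F z (insert h K) := fun z hz K hK =>
    fderiv_regDeriv hD hF hK hz.1 (hz.2 h (Finset.mem_singleton_self h)) (by simp [hkh])
  have hh' : h ∉ insert k T := by simp [hkh, hhT]
  have hk' : k ∉ insert h T := by simp [hT, Ne.symm hkh]
  constructor
  · refine eqOn_of_eqOn_nonrealPart hD {h} (hcα T) (hcβ (insert k T)) (fun z hz => ?_) hz
    obtain ⟨c1, -⟩ := dBar_eq_zero_iff.1 (hF.dBar_eq k hk.1 z hz.1) (insert h T) hk'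
    simp only
    rw [hα z hz T hhT, hβ z hz _ hh', c1, Finset.insert_comm]
  · refine eqOn_of_eqOn_nonrealPart hD {h} (hcα (insert k T)) (hcβ T).neg (fun z hz => ?_) hz
    obtain ⟨-, c2⟩ := dBar_eq_zero_iff.1 (hF.dBar_eq k hk.1 z hz.1) (insert h T) hk'
    simp only [Pi.neg_apply]
    rw [hα z hz _ hh', hβ z hz _ hhT, Finset.insert_comm h k, c2, smul_neg]

/-- Iterated extended spherical derivatives along a list of variables. -/
def regDerivList (l : List (Fin n)) (F : StemMap n) : StemMap n :=
  l.foldl (fun G h => regDeriv h G) F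

/-- Repetitions are excluded because each differentiation uses up holomorphy in its variable. -/
theorem isHolomorphicIn_regDerivList {D : Set (Fin n → ℂ)} (hD : IsOpen D) {l : List (Fin n)}
    (hl : l.Nodup) {A : Set (Fin n)} {F : StemMap n} (hF : IsHolomorphicIn D A F)
    (hA : ∀ h ∈ l, h ∈ A) : IsHolomorphicIn D (A \ {h | h ∈ l}) (regDerivList l F) := by
  induction l generalizing A F with
  | nil => simpa [regDerivList] using hF
  | cons a l ih =>
    rw [List.nodup_cons] at hl
    have h1 := ih hl.2 (IsHolomorphicIn.regDeriv hD hF (hA a (by simp))) fun h hh =>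
      ⟨hA h (by simp [hh]), fun hc => hl.1 (Set.mem_singleton_iff.1 hc ▸ hh)⟩
    have e : A \ {h | h ∈ a :: l} = (A \ {a}) \ {h | h ∈ l} := by
      ext x
      simp only [List.mem_cons, Set.mem_sdiff, Set.mem_ofPred_eq, Set.mem_singleton_iff]
      tauto
    rw [e]
    exact h1

theorem regDerivList_eq_sphDerivList {l : List (Fin n)} {F : StemMap n} {z : Fin n → ℂ}
    (hz : ∀ h ∈ l, (z h).im ≠ 0) : regDerivList l F z = sphDerivList l F z := by
  induction l generalizing F with
  | nil => rfl
  | cons a l ih =>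
    refine (ih (F := regDeriv a F) fun h hh => hz h (by simp [hh])).trans ?_
    exact sphDerivList_apply_congr l (regDeriv_eq_sphDeriv (hz a (by simp)) F)

theorem regDerivList_eq_zero (l : List (Fin n)) {F : StemMap n} {D : Set (Fin n → ℂ)}
    (hD : IsOpen D) (hl : l.Nodup) {A : Set (Fin n)} (hF : IsHolomorphicIn D A F)
    (hA : ∀ h ∈ l, h ∈ A) {z : Fin n → ℂ} (hz : z ∈ D) {T : Finset (Fin n)} {h : Fin n}
    (hT : h ∈ T) (hh : h ∈ l) : regDerivList l F z T = 0 := by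
  have hc := (isHolomorphicIn_regDerivList hD hl hF hA).continuousOn T
  refine eqOn_of_eqOn_nonrealPart hD l.toFinset (g := fun _ => 0) hc continuousOn_const
    (fun z hz => ?_) hz
  simp only
  rw [regDerivList_eq_sphDerivList fun k hk => hz.2 k (List.mem_toFinset.2 hk)]
  exact sphDerivList_eq_zero l (s := ∅) (by simp) z T ⟨h, hT, Or.inl hh⟩

theorem regDerivList_perm {l l' : List (Fin n)} (hp : l.Perm l') {F : StemMap n}
    {D : Set (Fin n → ℂ)} (hD : IsOpen D) (hl : l.Nodup) {A : Set (Fin n)}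
    (hF : IsHolomorphicIn D A F) (hA : ∀ h ∈ l, h ∈ A) :
    Set.EqOn (regDerivList l F) (regDerivList l' F) D := by
  intro z hz
  funext T
  have h1 := (isHolomorphicIn_regDerivList hD hl hF hA).continuousOn T
  have h2 := (isHolomorphicIn_regDerivList hD (hp.nodup_iff.1 hl) hF
    fun h hh => hA h (hp.mem_iff.2 hh)).continuousOn T
  refine eqOn_of_eqOn_nonrealPart hD l.toFinset h1 h2 (fun z hz => ?_) hz
  simp only
  rw [regDerivList_eq_sphDerivList fun k hk => hz.2 k (List.mem_toFinset.2 hk),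
    regDerivList_eq_sphDerivList fun k hk => hz.2 k (List.mem_toFinset.2 (hp.mem_iff.2 hk)),
    sphDerivList_perm hp]

/-! ### Harmonicity -/

theorem harmonicAt_sum {E F ι : Type} [NormedAddCommGroup E] [InnerProductSpace ℝ E]
    [FiniteDimensional ℝ E] [NormedAddCommGroup F] [NormedSpace ℝ F] {g : ι → E → F} {x : E}
    (s : Finset ι) (h : ∀ i ∈ s, InnerProductSpace.HarmonicAt (g i) x) :
    InnerProductSpace.HarmonicAt (fun y => ∑ i ∈ s, g i y) x := by
  classical
  induction s using Finset.induction_on with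
  | empty => simp
  | insert a s ha ih =>
    simp only [Finset.sum_insert ha]
    exact (h a (Finset.mem_insert_self _ _)).add
      (ih fun i hi => h i (Finset.mem_insert_of_mem hi))

theorem harmonicAt_regDeriv {D : Set (Fin n → ℂ)} (hD : IsOpen D) {A : Set (Fin n)}
    {B : StemMap n} (hB : IsHolomorphicIn D A B) {h : Fin n} (hA : h ∈ A) {T : Finset (Fin n)}
    (hT : h ∉ T) {w : Fin n → ℂ} {q : ℍ[ℝ]} (hq : Function.update w h (toComplex q) ∈ D) :
    InnerProductSpace.HarmonicAt
      (fun q => regDeriv h B (Function.update w h (toComplex q)) T) q := by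
  refine harmonicAt_of_forall_functional fun l => ?_
  have hO := isOpen_slot hD h w
  refine (InnerProductSpace.harmonicAt_congr_nhds ?_).1 (harmonicAt_complexSphDeriv hO
    (differentiableOn_slotFun hD hB l hA hT w) (fun ζ hζ => slotFun_conj hB.stem l hT hζ) hq)
  filter_upwards [(hO.preimage continuous_toComplex).mem_nhds hq] with p hp
  exact complexSphDeriv_slotFun hD hB l hA hT hp

/-- No set containing `h` contributes, so the units are constants in `x_h`, and the function is a
sum of left multiples of harmonic coefficients. -/
theorem isHarmonicIn_inducedFun {D : Set (Fin n → ℂ)} (hD : IsOpen D) {A : Set (Fin n)}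
    {G B : StemMap n} (hB : IsHolomorphicIn D A B) {h : Fin n} (hA : h ∈ A)
    (hG : Set.EqOn G (regDeriv h B) D) : IsHarmonicIn (circularization D) h (inducedFun G) := by
  intro y hy
  rw [mem_circularization_iff hB.stem.conj_mem] at hy
  set w : Fin n → ℂ := fun k => toComplex (y k) with hw
  have hq : Function.update w h (toComplex (y h)) ∈ D := by
    rw [show toComplex (y h) = w h from rfl, Function.update_eq_self]
    exact hy
  have hsum : InnerProductSpace.HarmonicAt (fun q => ∑ T ∈ (Finset.univ.erase h).powerset,
      orderedProd (fun k => unitOf (y k)) T *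
        regDeriv h B (Function.update w h (toComplex q)) T) (y h) :=
    harmonicAt_sum _ fun T hT =>
      (harmonicAt_regDeriv hD hB hA (notMem_of_mem_powerset_erase hT) hq).comp_CLM
        (ContinuousLinearMap.mul ℝ ℍ[ℝ] (orderedProd (fun k => unitOf (y k)) T))
  refine (InnerProductSpace.harmonicAt_congr_nhds ?_).1 hsum
  filter_upwards [((isOpen_slot hD h w).preimage continuous_toComplex).mem_nhds hq] with q hq
  have hq' : Function.update w h (toComplex q) ∈ D := hq
  rw [inducedFun, toComplex_update, ← hw, hG hq', sum_univ_eq_sum_erase h]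
  refine Finset.sum_congr rfl fun T hT => ?_
  have hT := notMem_of_mem_powerset_erase hT
  rw [regDeriv_of_mem (Finset.mem_insert_self h T), mul_zero, add_zero]
  congr 1
  refine orderedProd_congr fun a ha => ?_
  have : a ≠ h := fun hc => hT (hc ▸ ha)
  simp [this]

/-! ### The stem functions of the components -/

/-- `Z_j` commutes with the derivatives in the earlier variables. The new derivative then gives
`β_j⁻¹ (Z_j ⊗ G)_{T ∪ {j}} = β_j⁻¹ (α_j G_{T ∪ {j}} + β_j G_T)`. -/
theorem sphDerivs_firstVars_relations {j : ℕ} (hj : j < n) (F : StemMap n)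
    {K : Finset (Fin n)} (hK : K ⊆ firstVars n j) {z : Fin n → ℂ} (hz : (z ⟨j, hj⟩).im ≠ 0)
    {T : Finset (Fin n)} (hT : (⟨j, hj⟩ : Fin n) ∉ T) :
    (z ⟨j, hj⟩).im • sphDerivs (firstVars n (j + 1)) (stemVarMul K F) z T
        = sphDerivs (firstVars n j) (stemVarMul K F) z (insert ⟨j, hj⟩ T) ∧
    sphDerivs (firstVars n (j + 1)) (stemVarMul (insert ⟨j, hj⟩ K) F) z T
        = sphDerivs (firstVars n j) (stemVarMul K F) z T
          + (z ⟨j, hj⟩).re • sphDerivs (firstVars n (j + 1)) (stemVarMul K F) z T := by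
  have hjm := notMem_firstVars (n := n) hj
  have hjK : (⟨j, hj⟩ : Fin n) ∉ K := fun hc => hjm (hK hc)
  have hcomm : sphDerivs (firstVars n j) (stemMul (stemVar ⟨j, hj⟩) (stemVarMul K F))
      = stemMul (stemVar ⟨j, hj⟩) (sphDerivs (firstVars n j) (stemVarMul K F)) :=
    sphDerivList_stemVar_stemMul (fun hc => hjm ((Finset.mem_sort _).1 hc)) _
  rw [firstVars_succ hj, sphDerivs_insert hjm, sphDerivs_insert hjm, stemVarMul_insert hjK, hcomm,
    sphDeriv_of_notMem hT, sphDeriv_of_notMem hT, stemMul_stemVar,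
    if_pos (Finset.mem_insert_self _ _), Finset.erase_insert hT, smul_smul, mul_inv_cancel₀ hz,
    one_smul, smul_add, smul_smul, smul_smul, smul_smul, inv_mul_cancel₀ hz, one_smul,
    mul_comm (z ⟨j, hj⟩).re]
  exact ⟨rfl, add_comm _ _⟩

theorem sphDerivs_zero_stemVarMul_empty (F : StemMap n) :
    sphDerivs (firstVars n 0) (stemVarMul ∅ F) = F := by
  simp [firstVars_zero, sphDerivs, stemVarMul]

theorem component_decomposition {D : Set (Fin n → ℂ)} {F : StemMap n} (hF : IsStem D F)
    {m : ℕ} (hmn : m ≤ n) {x : Fin n → ℍ[ℝ]}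
    (hx : x ∈ circularization (nonrealPart (firstVars n m) D)) :
    inducedFun F x = ∑ K ∈ (firstVars n m).powerset, (-1) ^ (firstVars n m \ K).card *
      (orderedProd (fun h => star (x h)) (firstVars n m \ K) *
        component (firstVars n m) K F x) := by
  rw [mem_circularization_iff (conjAt_mem_nonrealPart hF.conj_mem _)] at hx
  have hz : ∀ j, j < m → ∀ hj : j < n, (toComplex (x ⟨j, hj⟩)).im ≠ 0 := fun j hjm hj =>
    hx.2 ⟨j, hj⟩ (mem_firstVars.2 hjm)
  have := decomposition x (fun j K => sphDerivs (firstVars n j) (stemVarMul K F)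
      fun h => toComplex (x h)) hmn
    (fun j _ K _ T h hT hh => sphDerivs_eq_zero _ _ _ hT (mem_firstVars.2 hh))
    (fun j hjm hj K hK T hT => (sphDerivs_firstVars_relations hj F hK
      (z := fun h => toComplex (x h)) (hz j hjm hj) hT).1)
    (fun j hjm hj K hK T hT => (sphDerivs_firstVars_relations hj F hK
      (z := fun h => toComplex (x h)) (hz j hjm hj) hT).2)
  rw [sphDerivs_zero_stemVarMul_empty] at this
  exact this

/-- The stem function inducing the extension of the component `𝓢^H_K` of a slice regular
function. -/
def regComponentStem (H K : Finset (Fin n)) (F : StemMap n) : StemMap n :=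
  regDerivList H.sort (stemVarMul K F)

/-! ### Components of a slice regular function on the whole domain. -/

section Regular

variable {D : Set (Fin n → ℂ)} {F : StemMap n}

theorem isHolomorphicIn_regComponentStem (hD : IsOpen D) (hF : IsHolomorphicIn D Set.univ F)
    (H K : Finset (Fin n)) :
    IsHolomorphicIn D (Set.univ \ {h | h ∈ H.sort}) (regComponentStem H K F) :=
  isHolomorphicIn_regDerivList hD (Finset.sort_nodup _ _) (hF.stemVarMulList hD _)
    fun _ _ => Set.mem_univ _

theorem regComponentStem_eq_zero (hD : IsOpen D) (hF : IsHolomorphicIn D Set.univ F)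
    (H K : Finset (Fin n)) {z : Fin n → ℂ} (hz : z ∈ D) {T : Finset (Fin n)} {h : Fin n}
    (hT : h ∈ T) (hh : h ∈ H) : regComponentStem H K F z T = 0 :=
  regDerivList_eq_zero (H.sort (· ≤ ·)) hD (Finset.sort_nodup _ _) (hF.stemVarMulList hD _)
    (fun _ _ => Set.mem_univ _) hz hT ((Finset.mem_sort _).2 hh)

theorem regComponentStem_eq {H : Finset (Fin n)} (K : Finset (Fin n)) {z : Fin n → ℂ}
    (hz : ∀ h ∈ H, (z h).im ≠ 0) :
    regComponentStem H K F z = sphDerivs H (stemVarMul K F) z :=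
  regDerivList_eq_sphDerivList fun h hh => hz h ((Finset.mem_sort _).1 hh)

/-- Multiplied out, the relations contain no `β_j⁻¹`; both sides are continuous on `D`, so the
identities at non-real points extend. -/
theorem regComponentStem_relations (hD : IsOpen D) (hF : IsHolomorphicIn D Set.univ F) {j : ℕ}
    (hj : j < n) {K : Finset (Fin n)} (hK : K ⊆ firstVars n j) {z : Fin n → ℂ} (hz : z ∈ D)
    {T : Finset (Fin n)} (hT : (⟨j, hj⟩ : Fin n) ∉ T) :
    (z ⟨j, hj⟩).im • regComponentStem (firstVars n (j + 1)) K F z T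
        = regComponentStem (firstVars n j) K F z (insert ⟨j, hj⟩ T) ∧
    regComponentStem (firstVars n (j + 1)) (insert ⟨j, hj⟩ K) F z T
        = regComponentStem (firstVars n j) K F z T
          + (z ⟨j, hj⟩).re • regComponentStem (firstVars n (j + 1)) K F z T := by
  have hc : ∀ H K T, ContinuousOn (fun z => regComponentStem H K F z T) D := fun H K T =>
    (isHolomorphicIn_regComponentStem hD hF H K).continuousOn T
  obtain ⟨hre, him⟩ := contDiff_slot (⟨j, hj⟩ : Fin n)
  have hsub : firstVars n j ⊆ firstVars n (j + 1) := by
    rw [firstVars_succ hj]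
    exact Finset.subset_insert _ _
  have key : ∀ z ∈ nonrealPart (firstVars n (j + 1)) D, (z ⟨j, hj⟩).im ≠ 0 ∧
      (∀ K, regComponentStem (firstVars n (j + 1)) K F z
        = sphDerivs (firstVars n (j + 1)) (stemVarMul K F) z) ∧
      ∀ K, regComponentStem (firstVars n j) K F z
        = sphDerivs (firstVars n j) (stemVarMul K F) z := fun z hz =>
    ⟨hz.2 _ (mem_firstVars.2 j.lt_succ_self), fun K => regComponentStem_eq K hz.2,
      fun K => regComponentStem_eq K fun h hh => hz.2 h (hsub hh)⟩
  constructor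
  · refine eqOn_of_eqOn_nonrealPart hD (firstVars n (j + 1))
      (him.continuous.continuousOn.smul (hc _ _ _)) (hc _ _ _) (fun z hz => ?_) hz
    obtain ⟨h0, k1, k2⟩ := key z hz
    simpa only [Pi.smul_apply', k1, k2] using (sphDerivs_firstVars_relations hj F hK h0 hT).1
  · refine eqOn_of_eqOn_nonrealPart hD (firstVars n (j + 1)) (hc _ _ _)
      ((hc _ _ _).add (hre.continuous.continuousOn.smul (hc _ _ _))) (fun z hz => ?_) hz
    obtain ⟨h0, k1, k2⟩ := key z hz
    simpa only [Pi.add_apply, Pi.smul_apply', k1, k2] using (sphDerivs_firstVars_relations hj F hK h0 hT).2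

theorem regComponent_decomposition (hD : IsOpen D) (hF : IsHolomorphicIn D Set.univ F)
    {m : ℕ} (hmn : m ≤ n) {x : Fin n → ℍ[ℝ]} (hx : x ∈ circularization D) :
    inducedFun F x = ∑ K ∈ (firstVars n m).powerset, (-1) ^ (firstVars n m \ K).card *
      (orderedProd (fun h => star (x h)) (firstVars n m \ K) *
        inducedFun (regComponentStem (firstVars n m) K F) x) := by
  rw [mem_circularization_iff hF.stem.conj_mem] at hx
  have := decomposition x (fun j K => regComponentStem (firstVars n j) K F
      fun h => toComplex (x h)) hmn
    (fun j _ K _ T h hT hh => regComponentStem_eq_zero hD hF _ _ hx hT (mem_firstVars.2 hh))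
    (fun j hjm hj K hK T hT => (regComponentStem_relations hD hF hj hK hx hT).1)
    (fun j hjm hj K hK T hT => (regComponentStem_relations hD hF hj hK hx hT).2)
  have h0 : regComponentStem (firstVars n 0) ∅ F = F := by
    simp [regComponentStem, firstVars_zero, regDerivList, stemVarMul]
  rw [h0] at this
  exact this

theorem isHarmonicIn_regComponent (hD : IsOpen D) (hF : IsHolomorphicIn D Set.univ F)
    (H K : Finset (Fin n)) {h : Fin n} (hh : h ∈ H) :
    IsHarmonicIn (circularization D) h (inducedFun (regComponentStem H K F)) := by
  have hZ : IsHolomorphicIn D Set.univ (stemVarMul K F) := hF.stemVarMulList hD _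
  have hB := isHolomorphicIn_regComponentStem hD hF (H.erase h) K
  refine isHarmonicIn_inducedFun hD hB (h := h) ⟨Set.mem_univ _, by simp⟩ fun z hz => ?_
  -- Any `h ∈ H` can be differentiated last, when the function is still holomorphic in `z_h`; this
  -- yields harmonicity in every treated variable.
  have hp : (H.sort (· ≤ ·)).Perm ((H.erase h).sort (· ≤ ·) ++ [h]) := by
    have := sort_insert_perm_concat (Finset.notMem_erase h H)
    rwa [Finset.insert_erase hh] at this
  refine (regDerivList_perm hp hD (Finset.sort_nodup _ _) hZ (fun _ _ => Set.mem_univ _) hz).trans ?_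
  simp [regDerivList, regComponentStem]

end Regular

/-- Regularity only provides some set and some holomorphic stem function. Uniqueness of both
identifies them with `D` and, on `D`, with `F`; openness of `D` then makes the derivatives agree. -/
theorem IsSliceRegular.isHolomorphicIn {D : Set (Fin n → ℂ)} {F : StemMap n} (hF : IsStem D F)
    {f : (Fin n → ℍ[ℝ]) → ℍ[ℝ]} (hf : Set.EqOn f (inducedFun F) (circularization D))
    (h : IsSliceRegular (circularization D) f) : IsOpen D ∧ IsHolomorphicIn D Set.univ F := by
  obtain ⟨D', F', hO, hF', ⟨hC, hB⟩, hΩ, hf'⟩ := h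
  obtain rfl := circularization_inj hF.conj_mem hF'.conj_mem hΩ
  have hFF : Set.EqOn F F' D :=
    hF.eqOn_of_inducedFun_eqOn hF' (hf.symm.trans hf')
  refine ⟨hO, hF, fun K => (hC K).congr fun z hz => congrFun (hFF hz) K, fun h _ z hz => ?_⟩
  rw [← hB h z hz]
  have e : ∀ K, fderiv ℝ (fun w => F w K) z = fderiv ℝ (fun w => F' w K) z := fun K =>
    Filter.EventuallyEq.fderiv_eq (by
      filter_upwards [hO.mem_nhds hz] with w hw using congrFun (hFF hw) K)
  have e1 : dAlpha h F z = dAlpha h F' z := funext fun K => by rw [dAlpha, dAlpha, e]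
  have e2 : dBeta h F z = dBeta h F' z := funext fun K => by rw [dBeta, dBeta, e]
  funext K
  rw [dBar, dBar, e1, e2]

end

end SliceH

/-! ### Assembly of the theorem. -/

open SliceH in
theorem corollary3p5 {n m : ℕ} (hm : 1 ≤ m) (hmn : m ≤ n)
    (D : Set (Fin n → ℂ)) (F : StemMap n) (hF : IsStem D F)
    (f : (Fin n → ℍ[ℝ]) → ℍ[ℝ]) (hf : Set.EqOn f (inducedFun F) (circularization D)) :
    -- the components of an arbitrary slice function, on the set where they are defined
    ((∀ x ∈ circularization (nonrealPart (firstVars n m) D),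
        f x = ∑ K ∈ (firstVars n m).powerset, (-1) ^ (firstVars n m \ K).card *
          (orderedProd (fun h => star (x h)) (firstVars n m \ K) *
            component (firstVars n m) K F x)) ∧
      ∀ K ⊆ firstVars n m,
        (∀ h ∈ firstVars n m,
          IsCircularIn (circularization (nonrealPart (firstVars n m) D)) h
            (component (firstVars n m) K F)) ∧
        (∀ hlt : m < n,
          IsSliceIn (circularization (nonrealPart (firstVars n m) D)) ⟨m, hlt⟩
            (component (firstVars n m) K F))) ∧
    -- for a slice regular function they extend continuously to the whole domain
    (IsSliceRegular (circularization D) f →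
      ∃ S : Finset (Fin n) → (Fin n → ℍ[ℝ]) → ℍ[ℝ],
        (∀ x ∈ circularization D,
          f x = ∑ K ∈ (firstVars n m).powerset, (-1) ^ (firstVars n m \ K).card *
            (orderedProd (fun h => star (x h)) (firstVars n m \ K) * S K x)) ∧
        ∀ K ⊆ firstVars n m,
          ContinuousOn (S K) (circularization D) ∧
          Set.EqOn (S K) (component (firstVars n m) K F)
            (circularization (nonrealPart (firstVars n m) D)) ∧
          (∀ h ∈ firstVars n m, IsCircularIn (circularization D) h (S K)) ∧
          (∀ hlt : m < n, IsSliceIn (circularization D) ⟨m, hlt⟩ (S K)) ∧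
          (∀ h ∈ firstVars n m, IsHarmonicIn (circularization D) h (S K))) := by
  constructor
  · have hS : ∀ K, IsStem (nonrealPart (firstVars n m) D)
        (sphDerivs (firstVars n m) (stemVarMul K F)) := fun K =>
      ((hF.stemVarMulList _).sphDerivList _).nonrealPart _
    refine ⟨fun x hx => ?_, fun K _ => ⟨fun h hh => ?_, fun hlt => ?_⟩⟩
    · have hxD : x ∈ circularization D := by
        obtain ⟨z, hz, J, hJ⟩ := hx
        exact ⟨z, hz.1, J, hJ⟩
      rw [hf hxD]
      exact component_decomposition hF hmn hx
    · exact isCircularIn_inducedFun (hS K) fun z _ T hT => sphDerivs_eq_zero _ _ z hT hh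
    · exact isSliceIn_inducedFun (hS K) fun z _ T h hT hh =>
        sphDerivs_eq_zero _ _ z hT (mem_firstVars.2 hh)
  · intro hreg
    obtain ⟨hD, hH⟩ := hreg.isHolomorphicIn hF hf
    have hC := fun K => isHolomorphicIn_regComponentStem hD hH (firstVars n m) K
    refine ⟨fun K => inducedFun (regComponentStem (firstVars n m) K F), fun x hx => ?_,
      fun K _ => ⟨?_, fun x hx => ?_, fun h hh => ?_, fun hlt => ?_, fun h hh => ?_⟩⟩
    · rw [hf hx]
      exact regComponent_decomposition hD hH hmn hx
    · exact continuousOn_inducedFun (hC K).stem (hC K).continuousOn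
    · have hz := (mem_circularization_iff (conjAt_mem_nonrealPart hF.conj_mem _)).1 hx
      simp only [inducedFun, component, regComponentStem_eq K hz.2]
    · exact isCircularIn_inducedFun (hC K).stem fun z hz T hT =>
        regComponentStem_eq_zero hD hH _ _ hz hT hh
    · exact isSliceIn_inducedFun (hC K).stem fun z hz T h hT hh =>
        regComponentStem_eq_zero hD hH _ _ hz hT (mem_firstVars.2 hh)
    · exact isHarmonicIn_regComponent hD hH _ K hh
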